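/- Let $E,A\in\mathbb{C}^{n\times n}$ and let $\mathcal{A}(s)=sE-A$ be a regular matrix pencil, i.e. $\det(sE-A)$ is not the zero polynomial. Put $\overline{\mathbb{C}}=\mathbb{C}\cup\{\infty\}$, $\mathcal{A}(\infty):=E$, and let the spectrum $\sigma(\mathcal{A})\subseteq\overline{\mathbb{C}}$ consist of all $\lambda\in\mathbb{C}$ for which $0$ is an eigenvalue of $\lambda E-A$, together with $\infty$ if $E$ is singular. A Jordan chain of length $m\ge 1$ at $\lambda\in\mathbb{C}$ is a tuple $(g_0,\dots,g_{m-1})$ in $\mathbb{C}^n$ with $g_0\neq 0$, $(A-\lambda E)g_0=0$ and $(A-\lambda E)g_j=Eg_{j-1}$ for $1\le j\le m-1$; at $\infty$ the conditions are $g_0\ne 0$, $Eg_0=0$ and $Eg_j=Ag_{j-1}$. For $\lambda\in\overline{\mathbb{C}}$ let $\mathcal{L}_\lambda(\mathcal{A})$ be the subspace of $\mathbb{C}^n$ spanned by all elements of all Jordan chains at $\lambda$, let $m_1(\lambda)$ be the length of the longest Jordan chain of $\mathcal{A}$ at $\lambda$, and let $M(\mathcal{A})=\sum_{\lambda\in\sigma(\mathcal{A})}m_1(\lambda)$.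 The rank of a pencil is the largest size of a minor that is not the zero polynomial. Let $\mu_1,\dots,\mu_l\in\overline{\mathbb{C}}$ be pairwise distinct and let $m_1,\dots,m_l\ge 1$ be integers with $\sum_{i=1}^l m_i=M(\mathcal{A})$. (a) There exist $\alpha\in\mathbb{C}\setminus\{0\}$, $\beta\in\mathbb{C}$ and $u,v\in\mathbb{C}^n$ such that for $\mathcal{P}(s)=(\alpha s-\beta)uv^*$ the pencil $\mathcal{A}+\mathcal{P}$ is regular, $$\sigma(\mathcal{A}+\mathcal{P})=\{\mu_1,\dots,\mu_l\}\cup\{\lambda\in\sigma(\mathcal{A}) : \dim\ker\mathcal{A}(\lambda)\ge 2\},\qquad (1)$$ and $$\dim\mathcal{L}_\lambda(\mathcal{A}+\mathcal{P})=\begin{cases}\dim\mathcal{L}_\lambda(\mathcal{A})-m_1(\lambda)+m_i, & \lambda=\mu_i\in\sigma(\mathcal{A}),\\ \dim\mathcal{L}_\lambda(\mathcal{A})-m_1(\lambda), & \lambda\in\sigma(\mathcal{A})\setminus\{\mu_1,\dots,\mu_l\},\\ m_i, & \lambda=\mu_i\notin\sigma(\mathcal{A}),\\ 0, & \lambda\notin\sigma(\mathcal{A})\cup\{\mu_1,\dots,\mu_l\}.\end{cases}\qquad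 (2)$$ Moreover $\mathcal{P}$ has rank one, except possibly if $n=0$, or if $n=1$ and $\infty\in\sigma(\mathcal{A})\cap\{\mu_1,\dots,\mu_l\}$ (then $\mathcal{P}$ may be zero). (b) If $E$ and $A$ are real, $\{\mu_1,\dots,\mu_l\}$ is invariant under complex conjugation (with $\overline{\infty}=\infty$) and $m_i=m_j$ whenever $\mu_j=\overline{\mu_i}$, then there exist $\alpha\in\mathbb{R}\setminus\{0\}$, $\beta\in\mathbb{R}$ and $u,v\in\mathbb{R}^n$ such that for $\mathcal{P}(s)=(\alpha s-\beta)uv^T$ the pencil $\mathcal{A}+\mathcal{P}$ is regular and (1) and (2) hold. Moreover $\mathcal{P}$ has rank one, except possibly in the cases excepted in (a), or if $n=2$ and some non-real $\mu_i$ lies in $\sigma(\mathcal{A})$ (then $\mathcal{P}$ may be zero). -/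

import Mathlib

open Polynomial
open scoped OnePoint

/-- The matrix pencil `s E - A`, given by its two complex `n × n` coefficient matrices. -/
@[ext]
structure MatrixPencil (n : ℕ) where
  E : Matrix (Fin n) (Fin n) ℂ
  A : Matrix (Fin n) (Fin n) ℂ

namespace MatrixPencil

noncomputable section

/-- `(s E - A) + (s F - G) = s (E + F) - (A + G)`. -/
instance (n : ℕ) : Add (MatrixPencil n) where
  add P Q := ⟨P.E + Q.E, P.A + Q.A⟩

/-- The pencil `s E - A` as a matrix with polynomial entries. -/
def poly {n : ℕ} (P : MatrixPencil n) : Matrix (Fin n) (Fin n) ℂ[X] :=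
  (X : ℂ[X]) • P.E.map C - P.A.map C

/-- A pencil is regular if its characteristic polynomial is not the zero polynomial. -/
def IsRegular {n : ℕ} (P : MatrixPencil n) : Prop :=
  P.poly.det ≠ 0

/-- The rank of a pencil: the largest size of a minor that is not the zero polynomial. -/
def rank {n : ℕ} (P : MatrixPencil n) : ℕ :=
  sSup {r | ∃ f g : Fin r → Fin n, (P.poly.submatrix f g).det ≠ 0}

/-- The value of the pencil at a point of `ℂ ∪ {∞}`: the matrix `z E - A` at `z ∈ ℂ`, and the
leading coefficient `E` at `∞`. -/
def eval {n : ℕ} (P : MatrixPencil n) : OnePoint ℂ → Matrix (Fin n) (Fin n) ℂ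
  | ∞ => P.E
  | (z : ℂ) => z • P.E - P.A

/-- The spectrum: those `z ∈ ℂ` for which `0` is an eigenvalue of `z E - A`, together with `∞`
if `E` is singular. -/
def spec {n : ℕ} (P : MatrixPencil n) : Set (OnePoint ℂ) :=
  {lam | match lam with
    | ∞ => ¬ IsUnit P.E
    | (z : ℂ) => Module.End.HasEigenvalue (Matrix.toLin' (z • P.E - P.A)) 0}

/-- The dimension of the kernel of the value of the pencil at a point of `ℂ ∪ {∞}`. -/
def dimKer {n : ℕ} (P : MatrixPencil n) (lam : OnePoint ℂ) : ℕ :=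
  Module.finrank ℂ (LinearMap.ker (Matrix.toLin' (P.eval lam)))

/-- `P.IsJordanChain lam g` says that `g 0, …, g k` is a Jordan chain (of length `k + 1`) of the
pencil at the point `lam` of `ℂ ∪ {∞}`. -/
def IsJordanChain {n : ℕ} (P : MatrixPencil n) (lam : OnePoint ℂ) {k : ℕ}
    (g : Fin (k + 1) → Fin n → ℂ) : Prop :=
  match lam with
  | ∞ =>
      g 0 ≠ 0 ∧ P.E.mulVec (g 0) = 0 ∧
        ∀ j : Fin k, P.E.mulVec (g j.succ) = P.A.mulVec (g j.castSucc)
  | (z : ℂ) =>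
      g 0 ≠ 0 ∧ (P.A - z • P.E).mulVec (g 0) = 0 ∧
        ∀ j : Fin k, (P.A - z • P.E).mulVec (g j.succ) = P.E.mulVec (g j.castSucc)

/-- The root subspace at `lam`: the subspace of all elements of all Jordan chains at `lam`. -/
def rootSubspace {n : ℕ} (P : MatrixPencil n) (lam : OnePoint ℂ) : Submodule ℂ (Fin n → ℂ) :=
  Submodule.span ℂ {x | ∃ (k : ℕ) (g : Fin (k + 1) → Fin n → ℂ),
    P.IsJordanChain lam g ∧ ∃ j, x = g j}

/-- The dimension of the root subspace. -/
def rootDim {n : ℕ} (P : MatrixPencil n) (lam : OnePoint ℂ) : ℕ :=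
  Module.finrank ℂ (P.rootSubspace lam)

/-- The length of the longest Jordan chain at `lam` (which is `0` if there is no chain). -/
def longestChain {n : ℕ} (P : MatrixPencil n) (lam : OnePoint ℂ) : ℕ :=
  sSup {m | ∃ (k : ℕ) (g : Fin (k + 1) → Fin n → ℂ), P.IsJordanChain lam g ∧ m = k + 1}

/-- The sum, over all eigenvalues of the pencil, of the lengths of the longest Jordan chains. -/
def sumLongestChains {n : ℕ} (P : MatrixPencil n) : ℕ :=
  ∑ᶠ lam ∈ P.spec, P.longestChain lam

/-- The pencil `(α s - β) u v^*`. -/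
def rankOnePencil {n : ℕ} (α β : ℂ) (u v : Fin n → ℂ) : MatrixPencil n :=
  ⟨α • Matrix.vecMulVec u (star v), β • Matrix.vecMulVec u (star v)⟩

/-- The pencil has real coefficient matrices. -/
def IsReal {n : ℕ} (P : MatrixPencil n) : Prop :=
  ∃ E₀ A₀ : Matrix (Fin n) (Fin n) ℝ, P.E = E₀.map Complex.ofReal ∧ P.A = A₀.map Complex.ofReal

/-- Complex conjugation on `ℂ ∪ {∞}`, fixing `∞`. -/
def conjPoint (lam : OnePoint ℂ) : OnePoint ℂ :=
  OnePoint.map (starRingEnd ℂ) lam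

/-- `Q` has exactly the points `μ i` and the eigenvalues of `P` of geometric multiplicity at least
two as eigenvalues, and the dimensions of its root subspaces are those of `P` with the longest
chain at every eigenvalue of `P` removed and `m i` added at `μ i`. -/
structure IsPlacement {n l : ℕ} (P Q : MatrixPencil n) (μ : Fin l → OnePoint ℂ) (m : Fin l → ℕ) :
    Prop where
  spec_eq : Q.spec = Set.range μ ∪ {lam | lam ∈ P.spec ∧ 2 ≤ P.dimKer lam}
  dim_of_target_of_spec : ∀ i, μ i ∈ P.spec →
    (Q.rootDim (μ i) : ℤ) = P.rootDim (μ i) - P.longestChain (μ i) + m i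
  dim_of_spec : ∀ lam ∈ P.spec, lam ∉ Set.range μ →
    (Q.rootDim lam : ℤ) = P.rootDim lam - P.longestChain lam
  dim_of_target : ∀ i, μ i ∉ P.spec → Q.rootDim (μ i) = m i
  dim_of_not_mem : ∀ lam, lam ∉ P.spec → lam ∉ Set.range μ → Q.rootDim lam = 0

end

end MatrixPencil

/-! Choose a real `γ`, distinct from all `μ i`, with `B = γE - A` invertible, and put `N = B⁻¹E`.
The chart `λ ↦ (γ - λ)⁻¹`, `∞ ↦ 0` carries the spectrum of the pencil to that of `N` and treats `∞`
like any other point. By `isJordanChain_iff` the Jordan chains at `λ` are chains of `N` at the image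
point `t`, twisted by a polynomial in `N` that is nonzero at `t`. The twist changes neither spans
nor lengths, so root dimensions are root multiplicities of the characteristic polynomial of `N`,
longest chains are those of its minimal polynomial `q`, and the sum of the longest chains is `deg
q`.

A perturbation `(s - γ) (Bu) v^*` vanishes at `γ`, so it keeps `B` and turns `N` into `N + u v^*`.
With `p` the monic polynomial having roots `chart γ (μ i)` of multiplicities `m i`, everything
reduces to solving `charpoly (N + u v^*) * q = p * charpoly N` (`isPlacement_of_charpoly`). The
quotient of the two characteristic polynomials is `1 - v^* (X - N)⁻¹ u`, and Horner's scheme expands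
`q (X - N)⁻¹` in powers of `X` with coefficients polynomials in `N`. If the annihilator of `u` is
generated by `q`, these coefficients applied to `u` are linearly independent, so `v` can prescribe
`q - p` arbitrarily in degrees below `deg q` (`exists_charpoly_add_vecMulVec_mul_minpoly`). For real
data the same argument runs over `ℝ`.

The perturbation is automatically nonzero if `p ≠ q`. If `p = q`, a nonunit factor of `q` of degree
less than `n` yields a nonzero perturbation that keeps the characteristic polynomial; the rank-one
exceptions arise where no such factor exists. -/

namespace Matrix

/-! ### Rank-one perturbations and characteristic polynomials -/

variable {F : Type*} [Field F] {n : ℕ}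

/-- A matrix has a vector whose annihilating polynomials are the multiples of its minimal
polynomial. -/
theorem exists_forall_aeval_mulVec_eq_zero_imp_minpoly_dvd (N : Matrix (Fin n) (Fin n) F) :
    ∃ u : Fin n → F, ∀ f : F[X], aeval N f *ᵥ u = 0 → minpoly F N ∣ f := by
  have : Module.Finite F[X] (Module.AEval' (toLin' N)) :=
    Module.Finite.of_restrictScalars_finite F _ _
  obtain ⟨x, hx⟩ :=
    Module.exists_ker_toSpanSingleton_eq_annihilator F[X] (Module.AEval' (toLin' N))
  obtain ⟨u, rfl⟩ := (Module.AEval'.of (toLin' N)).surjective x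
  refine ⟨u, fun f hf => ?_⟩
  have hmem : f ∈ LinearMap.ker (LinearMap.toSpanSingleton F[X] (Module.AEval' (toLin' N))
      (Module.AEval'.of (toLin' N) u)) := by
    rw [LinearMap.mem_ker, LinearMap.toSpanSingleton_apply]
    have h1 : aeval (toLin' N) f u = 0 := by
      have : aeval (toLinAlgEquiv' N) f = toLinAlgEquiv' (aeval N f) := aeval_algHom_apply
        (toLinAlgEquiv' : Matrix (Fin n) (Fin n) F ≃ₐ[F] _).toAlgHom N f
      have h2 : aeval (toLin' N) f = toLin' (aeval N f) := this
      rw [h2, toLin'_apply, hf]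
    rw [← Module.AEval.of_aeval_smul]
    simp [h1]
  rw [hx, ← span_minpoly_eq_annihilator, Ideal.mem_span_singleton,
    minpoly_toLin'] at hmem
  exact hmem

theorem coeff_iterate_divX (f : F[X]) (k j : ℕ) : (divX^[k] f).coeff j = f.coeff (j + k) := by
  induction k generalizing j with
  | zero => simp
  | succ k ih => rw [Function.iterate_succ_apply', coeff_divX, ih, add_right_comm, add_assoc]

/-- Horner's scheme for the division of `f(X) - f(N)` by `X - N`. -/
theorem charmatrix_mul_sum_iterate_divX (N : Matrix (Fin n) (Fin n) F) (f : F[X]) (k : ℕ) :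
    N.charmatrix * ∑ i ∈ Finset.range k, (X : F[X]) ^ i • (aeval N (divX^[i + 1] f)).map C =
      (X : F[X]) ^ k • (aeval N (divX^[k] f)).map C - (aeval N f).map C +
        (∑ i ∈ Finset.range k, X ^ i * C (f.coeff i)) • (1 : Matrix (Fin n) (Fin n) F[X]) := by
  induction k with
  | zero => simp
  | succ k ih =>
    have hstep : (aeval N (divX^[k] f)).map C =
        N.map C * (aeval N (divX^[k + 1] f)).map C + C (f.coeff k) • (1 : Matrix _ _ F[X]) := by
      conv_lhs => rw [← X_mul_divX_add (divX^[k] f), ← Function.iterate_succ_apply' divX]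
      rw [coeff_iterate_divX, zero_add, map_add, map_mul, aeval_X, aeval_C, Matrix.map_add _ (by simp),
        Matrix.map_mul, Algebra.algebraMap_eq_smul_one]
      congr 1
      ext i j : 2
      by_cases hij : i = j <;> simp [hij]
    rw [Finset.sum_range_succ, mul_add, ih, Finset.sum_range_succ, add_smul, hstep]
    have hc : N.charmatrix = (X : F[X]) • (1 : Matrix _ _ F[X]) - N.map C := by
      rw [charmatrix, scalar_apply, smul_one_eq_diagonal]; rfl
    rw [hc, sub_mul]
    simp only [smul_add, mul_smul, mul_smul_comm, smul_mul_assoc, one_mul, pow_succ]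
    abel

/-- The matrix determinant lemma with `Q / f` as the inverse of `X - N`, cleared of denominators.
Multiplying `X - N - u vᵀ` by `Q` gives `f - u (vᵀ Q)`, whose determinant is the characteristic
polynomial of a rank-one matrix evaluated at `f`. -/
theorem charpoly_add_vecMulVec_mul (N : Matrix (Fin n) (Fin n) F) (u v : Fin n → F) {f : F[X]}
    (hf : f ≠ 0) {Q : Matrix (Fin n) (Fin n) F[X]}
    (hQ : N.charmatrix * Q = f • (1 : Matrix (Fin n) (Fin n) F[X])) :
    (N + vecMulVec u v).charpoly * f =
      (f - (C ∘ v) ⬝ᵥ Q *ᵥ (C ∘ u)) * N.charpoly := by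
  -- Below, `f ^ n = f * f ^ (n - 1)` needs `n > 0`, since the subtraction truncates.
  rcases Nat.eq_zero_or_pos n with rfl | hn
  · simp [charpoly]
  have hdet : N.charpoly * Q.det = f ^ n := by
    rw [charpoly, ← det_mul, hQ, det_smul, det_one]; simp
  have hQ0 : Q.det ≠ 0 := by
    intro h; rw [h, mul_zero] at hdet; exact pow_ne_zero n hf hdet.symm
  have hchar : (N + vecMulVec u v).charmatrix = N.charmatrix - vecMulVec (C ∘ u) (C ∘ v) := by
    ext i j : 2
    simp [charmatrix_apply, vecMulVec_apply]; ring
  have hprod : (N + vecMulVec u v).charpoly * Q.det =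
      f ^ n - (C ∘ v) ⬝ᵥ Q *ᵥ (C ∘ u) * f ^ (n - 1) := by
    rw [charpoly, ← det_mul, hchar, sub_mul, hQ, vecMulVec_mul, smul_one_eq_diagonal]
    have := eval_charpoly (vecMulVec (C ∘ u) ((C ∘ v) ᵥ* Q)) f
    rw [charpoly_vecMulVec] at this
    rw [← scalar_apply, ← this]
    simp [dotProduct_mulVec, dotProduct_comm (C ∘ u)]
  apply mul_right_cancel₀ hQ0
  have hpow : f ^ n = f * f ^ (n - 1) := by rw [← pow_succ']; congr 1; omega
  calc _ = ((N + vecMulVec u v).charpoly * Q.det) * f := by ring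
    _ = (f - (C ∘ v) ⬝ᵥ Q *ᵥ (C ∘ u)) * f ^ n := by rw [hprod, hpow]; ring
    _ = _ := by rw [← hdet]; ring

theorem minpoly_monic (N : Matrix (Fin n) (Fin n) F) : (minpoly F N).Monic :=
  minpoly.monic (Matrix.isIntegral N)

theorem iterate_divX_natDegree {q : F[X]} (hq : q.Monic) : divX^[q.natDegree] q = 1 := by
  ext j
  rw [coeff_iterate_divX, coeff_one]
  split_ifs with h
  · subst h; simpa using! hq.coeff_natDegree
  · exact coeff_eq_zero_of_natDegree_lt (by omega)

/-- Horner's scheme for `q = minpoly F N`, run for `deg q` steps, ends with leading term `X ^ deg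
q`; as `q(N) = 0`, the right-hand side collapses to `q • 1`. -/
theorem charpoly_add_vecMulVec_mul_minpoly (N : Matrix (Fin n) (Fin n) F) (u v : Fin n → F) :
    (N + vecMulVec u v).charpoly * minpoly F N =
      (minpoly F N - ∑ i ∈ Finset.range (minpoly F N).natDegree,
        X ^ i * C (v ⬝ᵥ aeval N (divX^[i + 1] (minpoly F N)) *ᵥ u)) * N.charpoly := by
  have hQ := charmatrix_mul_sum_iterate_divX N (minpoly F N) (minpoly F N).natDegree
  have hsum : (∑ i ∈ Finset.range (minpoly F N).natDegree, X ^ i * C ((minpoly F N).coeff i)) =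
      minpoly F N - X ^ (minpoly F N).natDegree := by
    rw [eq_sub_iff_add_eq]
    conv_rhs => rw [N.minpoly_monic.as_sum]
    rw [add_comm]
    simp_rw [mul_comm]
  rw [hsum, iterate_divX_natDegree N.minpoly_monic, minpoly.aeval, map_one,
    Matrix.map_one _ C_0 C_1, Matrix.map_zero _ C_0, sub_zero, ← add_smul, add_sub_cancel] at hQ
  rw [charpoly_add_vecMulVec_mul N u v N.minpoly_monic.ne_zero hQ, sum_mulVec, dotProduct_sum]
  congr 2
  refine Finset.sum_congr rfl fun i _ => ?_
  rw [smul_mulVec, dotProduct_smul, smul_eq_mul, RingHom.map_dotProduct]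
  congr 2
  ext j : 1
  simp [RingHom.map_mulVec, Function.comp_def]

/-- The Horner quotients of a monic `q` are monic of distinct degrees below `deg q`. A relation
among their values at `u` is a polynomial of degree less than `deg q` annihilating `u`, hence zero.
-/
theorem linearIndependent_aeval_iterate_divX_mulVec {N : Matrix (Fin n) (Fin n) F} {u : Fin n → F}
    (hu : ∀ f : F[X], aeval N f *ᵥ u = 0 → minpoly F N ∣ f) :
    LinearIndependent F fun i : Fin (minpoly F N).natDegree =>
      aeval N (divX^[(i : ℕ) + 1] (minpoly F N)) *ᵥ u := by
  set q := minpoly F N with hq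
  have hqm : q.Monic := N.minpoly_monic
  rw [Fintype.linearIndependent_iff]
  intro a ha
  set g : F[X] := ∑ i : Fin q.natDegree, C (a i) * divX^[(i : ℕ) + 1] q with hg
  have hgc : ∀ j, g.coeff j = ∑ i : Fin q.natDegree, a i * q.coeff (j + (i + 1)) := by
    intro j; simp_rw [hg, finsetSum_coeff, coeff_C_mul, coeff_iterate_divX]
  have hgu : aeval N g *ᵥ u = 0 := by
    rw [← ha, hg, map_sum, sum_mulVec]
    refine Finset.sum_congr rfl fun i _ => ?_
    rw [map_mul, aeval_C, ← Algebra.smul_def, smul_mulVec]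
  have hg0 : g = 0 := by
    refine eq_zero_of_dvd_of_degree_lt (hu g hgu) ?_
    rw [degree_eq_natDegree hqm.ne_zero, degree_lt_iff_coeff_zero]
    intro j hj
    rw [hgc]
    refine Finset.sum_eq_zero fun i _ => ?_
    rw [coeff_eq_zero_of_natDegree_lt (by omega), mul_zero]
  suffices ∀ (k : ℕ) (i : Fin q.natDegree), (i : ℕ) = k → a i = 0 from fun i => this i i rfl
  intro k
  induction k using Nat.strong_induction_on with
  | _ k ih =>
    rintro i rfl
    -- In this degree the `i`-th quotient has its leading coefficient, later ones have smaller
    -- degree, and earlier ones drop out by induction.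
    have := hgc (q.natDegree - 1 - i)
    rw [hg0, coeff_zero, Finset.sum_eq_single i] at this
    · rw [show q.natDegree - 1 - i + (i + 1) = q.natDegree by omega, hqm.coeff_natDegree,
        mul_one] at this
      exact this.symm
    · intro j _ hj
      rcases lt_or_gt_of_ne (fun h => hj (Fin.ext h) : (j : ℕ) ≠ i) with h | h
      · rw [ih j h j rfl, zero_mul]
      · rw [coeff_eq_zero_of_natDegree_lt (by omega), mul_zero]
    · simp

theorem exists_dotProduct_eq_of_linearIndependent {ι : Type*} {w : ι → Fin n → F}
    (hw : LinearIndependent F w) (c : ι → F) : ∃ v : Fin n → F, ∀ i, v ⬝ᵥ w i = c i := by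
  obtain ⟨φ, hφ⟩ := LinearMap.exists_extend ((Module.Basis.span hw).constr F c)
  obtain ⟨v, rfl⟩ := (dotProductEquiv F (Fin n)).surjective φ
  refine ⟨v, fun i => ?_⟩
  have h := congr($hφ (Module.Basis.span hw i))
  rwa [Module.Basis.constr_basis, LinearMap.comp_apply, Submodule.subtype_apply,
    Module.Basis.span_apply, dotProductEquiv_apply_apply] at h

theorem sum_range_C_mul_X_pow_of_degree_lt {g : F[X]} {k : ℕ} (hg : g.degree < k) :
    ∑ i ∈ Finset.range k, C (g.coeff i) * X ^ i = g := by
  by_cases h0 : g = 0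
  · simp [h0]
  · exact (as_sum_range_C_mul_X_pow' g ((natDegree_lt_iff_degree_lt h0).2 hg)).symm

/-- A rank-one perturbation can replace the minimal polynomial as a factor of the characteristic
polynomial by any monic polynomial of the same degree. -/
theorem exists_charpoly_add_vecMulVec_mul_minpoly (N : Matrix (Fin n) (Fin n) F) {p : F[X]}
    (hp : p.Monic) (hdeg : p.natDegree = (minpoly F N).natDegree) :
    ∃ u v : Fin n → F, (N + vecMulVec u v).charpoly * minpoly F N = p * N.charpoly := by
  obtain ⟨u, hu⟩ := exists_forall_aeval_mulVec_eq_zero_imp_minpoly_dvd N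
  obtain ⟨v, hv⟩ := exists_dotProduct_eq_of_linearIndependent
    (linearIndependent_aeval_iterate_divX_mulVec hu) fun i => (minpoly F N - p).coeff i
  refine ⟨u, v, ?_⟩
  rw [charpoly_add_vecMulVec_mul_minpoly]
  congr 1
  have hlt : (minpoly F N - p).degree < ((minpoly F N).natDegree : ℕ) := by
    rw [← degree_eq_natDegree N.minpoly_monic.ne_zero]
    refine degree_sub_lt_left ?_ N.minpoly_monic.ne_zero ?_
    · rw [degree_eq_natDegree hp.ne_zero, hdeg, degree_eq_natDegree N.minpoly_monic.ne_zero]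
    · rw [N.minpoly_monic.leadingCoeff, hp.leadingCoeff]
  rw [sub_eq_iff_eq_add, ← sub_eq_iff_eq_add', ← sum_range_C_mul_X_pow_of_degree_lt hlt]
  refine Finset.sum_congr rfl fun i hi => ?_
  rw [← hv ⟨i, Finset.mem_range.1 hi⟩, mul_comm]

/-- A nonzero rank-one perturbation that keeps the characteristic polynomial. -/
theorem exists_ne_zero_charpoly_add_vecMulVec (N : Matrix (Fin n) (Fin n) F) {f : F[X]}
    (hf : f ∣ minpoly F N) (hunit : ¬ IsUnit f) (hdeg : f.natDegree < n) :
    ∃ u v : Fin n → F, u ≠ 0 ∧ v ≠ 0 ∧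
      (N + vecMulVec u v).charpoly * minpoly F N = minpoly F N * N.charpoly := by
  have hq0 := N.minpoly_monic.ne_zero
  have hf0 : f ≠ 0 := ne_zero_of_dvd_ne_zero hq0 hf
  obtain ⟨g, hg⟩ := hf
  -- Otherwise the cofactor of `f` in the minimal polynomial would already annihilate `N`.
  have hdet : (aeval N f).det = 0 := by
    by_contra h
    have hu : IsUnit (aeval N f) := (isUnit_iff_isUnit_det _).2 (Ne.isUnit h)
    have h1 : aeval N f * aeval N g = 0 := by rw [← map_mul, ← hg, minpoly.aeval]
    have h2 : aeval N g = 0 := by rwa [hu.mul_right_eq_zero] at h1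
    have h3 : f * g ∣ 1 * g := by rw [← hg, one_mul]; exact minpoly.dvd F N h2
    have hg0 : g ≠ 0 := by rintro rfl; exact hq0 (by simpa using hg)
    exact hunit (isUnit_of_dvd_one ((mul_dvd_mul_iff_right hg0).1 h3))
  obtain ⟨u, hu0, hu⟩ := exists_mulVec_eq_zero_iff.2 hdet
  -- Since `f(N) u = 0`, this is the whole Krylov space of `u`. It is proper because `deg f < n`,
  -- and any `v` orthogonal to it makes all correction terms vanish.
  set W := Submodule.span F (Set.range fun i : Fin f.natDegree => (N ^ (i : ℕ)) *ᵥ u) with hW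
  have hWtop : W < ⊤ := by
    rw [lt_top_iff_ne_top]
    intro h
    have h1 := finrank_range_le_card (R := F) fun i : Fin f.natDegree => (N ^ (i : ℕ)) *ᵥ u
    rw [Set.finrank, ← hW, h] at h1
    rw [finrank_top, Module.finrank_fin_fun, Fintype.card_fin] at h1
    omega
  obtain ⟨φ, hφ0, hφ⟩ := Submodule.exists_le_ker_of_lt_top W hWtop
  obtain ⟨v, rfl⟩ := (dotProductEquiv F (Fin n)).surjective φ
  have key : ∀ h : F[X], v ⬝ᵥ aeval N h *ᵥ u = 0 := by
    intro h
    have hmod : aeval N h *ᵥ u = aeval N (h % f) *ᵥ u := by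
      conv_lhs => rw [← EuclideanDomain.mod_add_div h f]
      rw [map_add, mul_comm f, map_mul, add_mulVec, ← mulVec_mulVec, hu, mulVec_zero, add_zero]
    have hlt : (h % f).degree < (f.natDegree : ℕ) := by
      rw [← degree_eq_natDegree hf0]; exact EuclideanDomain.mod_lt h hf0
    have hmem : aeval N (h % f) *ᵥ u ∈ W := by
      rw [← sum_range_C_mul_X_pow_of_degree_lt hlt, map_sum, sum_mulVec]
      refine Submodule.sum_mem _ fun i hi => ?_
      rw [map_mul, aeval_C, ← Algebra.smul_def, smul_mulVec, map_pow, aeval_X]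
      exact W.smul_mem _ (Submodule.subset_span ⟨⟨i, Finset.mem_range.1 hi⟩, rfl⟩)
    rw [hmod]
    simpa using hφ hmem
  refine ⟨u, v, hu0, fun h => hφ0 (by rw [h, map_zero]), ?_⟩
  rw [charpoly_add_vecMulVec_mul_minpoly]
  simp_rw [key]
  simp

/-- For `p ≠ minpoly F N` the characteristic polynomial changes, which forces `u vᵀ ≠ 0`; only `p =
minpoly F N` needs the separate construction. -/
theorem exists_charpoly_add_vecMulVec (N : Matrix (Fin n) (Fin n) F) {p : F[X]}
    (hp : p.Monic) (hdeg : p.natDegree = (minpoly F N).natDegree) :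
    ∃ u v : Fin n → F, (N + vecMulVec u v).charpoly * minpoly F N = p * N.charpoly ∧
      ((p = minpoly F N → ∃ f, f ∣ minpoly F N ∧ ¬ IsUnit f ∧ f.natDegree < n) →
        u ≠ 0 ∧ v ≠ 0) := by
  by_cases hpq : p = minpoly F N ∧ ∃ f, f ∣ minpoly F N ∧ ¬ IsUnit f ∧ f.natDegree < n
  · obtain ⟨rfl, f, hf, hunit, hlt⟩ := hpq
    obtain ⟨u, v, hu, hv, h⟩ := exists_ne_zero_charpoly_add_vecMulVec N hf hunit hlt
    exact ⟨u, v, h, fun _ => ⟨hu, hv⟩⟩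
  · obtain ⟨u, v, h⟩ := exists_charpoly_add_vecMulVec_mul_minpoly N hp hdeg
    refine ⟨u, v, h, fun hf => ?_⟩
    have hne : p ≠ minpoly F N := fun h => hpq ⟨h, hf h⟩
    have key : vecMulVec u v ≠ 0 := by
      intro h0
      rw [h0, add_zero, mul_comm] at h
      exact hne (mul_right_cancel₀ N.charpoly_monic.ne_zero h).symm
    constructor
    · rintro rfl; simp at key
    · rintro rfl; simp at key

end Matrix

/-! ### Generalized eigenspaces and the minimal polynomial -/

namespace Module.End

variable {K V : Type*} [Field K] [AddCommGroup V] [Module K V]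

theorem aeval_X_sub_C (f : End K V) (μ : K) : aeval f (X - C μ) = f - algebraMap K (End K V) μ := by
  simp

theorem commute_aeval (f : End K V) (p q : K[X]) : Commute (aeval f p) (aeval f q) :=
  (Commute.all p q).map (aeval f)

theorem mem_genEigenspace_iff_aeval {f : End K V} {μ : K} {k : ℕ} {x : V} :
    x ∈ f.genEigenspace μ k ↔ aeval f ((X - C μ) ^ k) x = 0 := by
  rw [mem_genEigenspace_nat, LinearMap.mem_ker, map_pow, aeval_X_sub_C, Algebra.algebraMap_eq_smul_one]

theorem isCoprime_of_eval_ne_zero {g : K[X]} {μ : K} (hg : g.eval μ ≠ 0) (k : ℕ) :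
    IsCoprime g ((X - C μ) ^ k) := by
  apply IsCoprime.pow_right
  refine ((irreducible_X_sub_C μ).coprime_iff_not_dvd.2 ?_).symm
  rwa [dvd_iff_isRoot]

variable [FiniteDimensional K V]

theorem minpoly_ne_zero (f : End K V) : minpoly K f ≠ 0 :=
  minpoly.ne_zero (Algebra.IsIntegral.isIntegral f)

theorem exists_minpoly_eq_pow_mul (f : End K V) (μ : K) :
    ∃ g : K[X], minpoly K f = (X - C μ) ^ (minpoly K f).rootMultiplicity μ * g ∧ g.eval μ ≠ 0 := by
  obtain ⟨g, hg, hdvd⟩ := exists_eq_pow_rootMultiplicity_mul_and_not_dvd _ f.minpoly_ne_zero μ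
  exact ⟨g, hg, by rwa [dvd_iff_isRoot] at hdvd⟩

/-- The ascending chain of generalized eigenspaces is stationary from the multiplicity in the
minimal polynomial on. -/
theorem maxGenEigenspace_eq_genEigenspace_rootMultiplicity (f : End K V) (μ : K) :
    f.maxGenEigenspace μ = f.genEigenspace μ ((minpoly K f).rootMultiplicity μ : ℕ) := by
  apply le_antisymm _ (f.genEigenspace_le_maximal μ _)
  obtain ⟨g, hg, hgμ⟩ := f.exists_minpoly_eq_pow_mul μ
  set k := (minpoly K f).rootMultiplicity μ
  intro x hx
  rw [maxGenEigenspace_eq, mem_genEigenspace_iff_aeval] at hx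
  rw [mem_genEigenspace_iff_aeval]
  obtain ⟨a, b, hab⟩ := isCoprime_of_eval_ne_zero hgμ (f.maxGenEigenspaceIndex μ)
  -- The Bézout identity for `g` and a high power of `X - μ`, multiplied by `(X - μ) ^ k`: both
  -- summands annihilate `x`.
  have h : (X - C μ) ^ k = a * minpoly K f +
      b * (X - C μ) ^ k * (X - C μ) ^ (f.maxGenEigenspaceIndex μ) := by
    rw [hg]; linear_combination (-(X - C μ) ^ k) * hab
  rw [h, map_add, map_mul, map_mul _ (b * _), minpoly.aeval, mul_zero, zero_add, mul_apply, hx,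
    map_zero]

/-- Otherwise one factor `X - μ` could be cancelled from the minimal polynomial. -/
theorem exists_mem_genEigenspace_notMem {f : End K V} {μ : K} {k : ℕ}
    (hk : (minpoly K f).rootMultiplicity μ = k + 1) :
    ∃ x ∈ f.genEigenspace μ (k + 1 : ℕ), x ∉ f.genEigenspace μ k := by
  obtain ⟨g, hg, hgμ⟩ := f.exists_minpoly_eq_pow_mul μ
  rw [hk] at hg
  by_contra! h
  have h0 : aeval f ((X - C μ) ^ k * g) = 0 := by
    ext y
    rw [map_mul, mul_apply, LinearMap.zero_apply, ← mem_genEigenspace_iff_aeval]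
    apply h
    rw [mem_genEigenspace_iff_aeval, ← mul_apply, ← map_mul, ← hg, minpoly.aeval,
      LinearMap.zero_apply]
  have h1 := minpoly.dvd K f h0
  have h2 : (X - C μ) ^ k * g ≠ 0 := by
    intro h; apply f.minpoly_ne_zero; rw [hg, pow_succ', mul_assoc, h, mul_zero]
  rw [hg, pow_succ', mul_assoc] at h1
  have h3 : (X - C μ) * ((X - C μ) ^ k * g) ∣ 1 * ((X - C μ) ^ k * g) := by rwa [one_mul]
  exact (irreducible_X_sub_C μ).not_isUnit (isUnit_of_dvd_one ((mul_dvd_mul_iff_right h2).1 h3))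

/-- Once the chain of kernels stalls it is constant, contradicting the strict last step given by
`exists_mem_genEigenspace_notMem`. -/
theorem genEigenspace_lt_succ {f : End K V} {μ : K} {j : ℕ}
    (hj : j < (minpoly K f).rootMultiplicity μ) :
    f.genEigenspace μ j < f.genEigenspace μ (j + 1 : ℕ) := by
  refine lt_of_le_of_ne ((f.genEigenspace μ).monotone (by exact_mod_cast j.le_succ)) fun h => ?_
  have hst : ∀ i, f.genEigenspace μ (j + i : ℕ) = f.genEigenspace μ j := by
    intro i
    induction i with
    | zero => rfl
    | succ i ih =>
      apply le_antisymm _ ((f.genEigenspace μ).monotone (by exact_mod_cast Nat.le_add_right _ _))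
      intro x hx
      have h1 : aeval f (X - C μ) x ∈ f.genEigenspace μ (j + i : ℕ) := by
        rw [mem_genEigenspace_iff_aeval, ← mul_apply, ← map_mul, ← pow_succ]
        exact mem_genEigenspace_iff_aeval.1 hx
      rw [ih, mem_genEigenspace_iff_aeval, ← mul_apply, ← map_mul, ← pow_succ,
        ← mem_genEigenspace_iff_aeval, ← h] at h1
      exact h1
  obtain ⟨k, hk⟩ := Nat.exists_eq_succ_of_ne_zero (Nat.ne_zero_of_lt hj)
  obtain ⟨x, hx, hx'⟩ := exists_mem_genEigenspace_notMem hk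
  apply hx'
  obtain ⟨i, rfl⟩ : ∃ i, k = j + i := ⟨k - j, by omega⟩
  rw [hst, ← hst (i + 1)]
  exact hx

/-- The map `(f - μ) ^ j` sends the `(j + 1)`-st kernel into the eigenspace, with kernel the `j`-th
one. -/
theorem finrank_genEigenspace_le_mul (f : End K V) (μ : K) (j : ℕ) :
    finrank K (f.genEigenspace μ j) ≤ j * finrank K (f.eigenspace μ) := by
  induction j with
  | zero => simp
  | succ j ih =>
    set T := aeval f ((X - C μ) ^ j)
    set W := f.genEigenspace μ (j + 1 : ℕ)
    have hrn := LinearMap.finrank_range_add_finrank_ker (T.domRestrict W)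
    have hrange : LinearMap.range (T.domRestrict W) ≤ f.eigenspace μ := by
      rintro _ ⟨x, rfl⟩
      have hx := mem_genEigenspace_iff_aeval.1 x.2
      rw [pow_succ', map_mul, mul_apply, aeval_X_sub_C] at hx
      rw [mem_eigenspace_iff]
      rwa [LinearMap.sub_apply, sub_eq_zero, Module.algebraMap_end_apply] at hx
    have hker : finrank K (LinearMap.ker (T.domRestrict W)) ≤ finrank K (f.genEigenspace μ j) := by
      rw [← Submodule.finrank_map_subtype_eq]
      apply Submodule.finrank_mono
      rintro _ ⟨x, hx, rfl⟩
      exact mem_genEigenspace_iff_aeval.2 hx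
    have := Submodule.finrank_mono hrange
    rw [add_mul, one_mul]
    omega

theorem finrank_eigenspace_add_le {f : End K V} {μ : K} {j : ℕ}
    (hj : j < (minpoly K f).rootMultiplicity μ) :
    finrank K (f.eigenspace μ) + j ≤ finrank K (f.genEigenspace μ (j + 1 : ℕ)) := by
  induction j with
  | zero => rfl
  | succ j ih =>
    have h1 := ih (by omega)
    have h2 := Submodule.finrank_lt_finrank_of_lt (genEigenspace_lt_succ hj)
    omega

/-- The geometric multiplicity is at least two if and only if the algebraic multiplicity exceeds
the multiplicity in the minimal polynomial. -/
theorem two_le_finrank_eigenspace_iff (f : End K V) (μ : K) :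
    2 ≤ finrank K (f.eigenspace μ) ↔
      (minpoly K f).rootMultiplicity μ < f.charpoly.rootMultiplicity μ := by
  rw [← LinearMap.finrank_maxGenEigenspace_eq, maxGenEigenspace_eq_genEigenspace_rootMultiplicity]
  have hle := f.finrank_genEigenspace_le_mul μ ((minpoly K f).rootMultiplicity μ)
  constructor
  · intro h
    have hroot : (minpoly K f).rootMultiplicity μ ≠ 0 := by
      intro h0
      have hev : f.HasEigenvalue μ := by
        rw [hasEigenvalue_iff]; intro hb; rw [hb, finrank_bot] at h; omega
      have := (rootMultiplicity_pos f.minpoly_ne_zero).2 (isRoot_of_hasEigenvalue hev)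
      omega
    obtain ⟨k, hk⟩ := Nat.exists_eq_succ_of_ne_zero hroot
    have := finrank_eigenspace_add_le (f := f) (μ := μ) (j := k) (by omega)
    rw [hk]
    simp only [Nat.succ_eq_add_one]
    omega
  · intro h
    by_contra! h2
    have : (minpoly K f).rootMultiplicity μ * finrank K (f.eigenspace μ) ≤
      (minpoly K f).rootMultiplicity μ * 1 := Nat.mul_le_mul_left _ (by omega)
    omega

end Module.End

/-! ### Twisted Jordan chains -/

namespace Module.End

variable {K V : Type*} [Field K] [AddCommGroup V] [Module K V]

/-- A twisted Jordan chain `T g₀ = 0`, `T gⱼ₊₁ = R gⱼ` with `g₀ ≠ 0`. -/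
def IsTwistedChain (T R : End K V) {k : ℕ} (g : Fin (k + 1) → V) : Prop :=
  g 0 ≠ 0 ∧ T (g 0) = 0 ∧ ∀ j : Fin k, T (g j.succ) = R (g j.castSucc)

variable {f : End K V} {μ : K} {r : K[X]} {k : ℕ} {g : Fin (k + 1) → V}

theorem IsTwistedChain.pow_apply (h : IsTwistedChain (aeval f (X - C μ)) (aeval f r) g)
    (j : Fin (k + 1)) : aeval f ((X - C μ) ^ (j : ℕ)) (g j) = aeval f (r ^ (j : ℕ)) (g 0) := by
  induction j using Fin.induction with
  | zero => simp
  | succ j ih =>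
    rw [Fin.val_succ, pow_succ, map_mul, mul_apply, h.2.2 j, ← mul_apply,
      (commute_aeval f _ _).eq, mul_apply, ← Fin.val_castSucc, ih, ← mul_apply, ← map_mul,
      ← pow_succ']

theorem IsTwistedChain.mem_genEigenspace
    (h : IsTwistedChain (aeval f (X - C μ)) (aeval f r) g) (j : Fin (k + 1)) :
    g j ∈ f.genEigenspace μ ((j : ℕ) + 1 : ℕ) := by
  rw [mem_genEigenspace_iff_aeval, pow_succ', map_mul, mul_apply, h.pow_apply, ← mul_apply,
    (commute_aeval f _ _).eq, mul_apply, h.2.1, map_zero]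

theorem IsTwistedChain.notMem_genEigenspace (hr : r.eval μ ≠ 0)
    (h : IsTwistedChain (aeval f (X - C μ)) (aeval f r) g) (j : Fin (k + 1)) :
    g j ∉ f.genEigenspace μ (j : ℕ) := by
  rw [mem_genEigenspace_iff_aeval, h.pow_apply]
  intro h0
  obtain ⟨a, b, hab⟩ := isCoprime_of_eval_ne_zero
    (g := r ^ (j : ℕ)) (by rw [eval_pow]; exact pow_ne_zero _ hr) 1
  apply h.1
  have := congr(aeval f $hab (g 0))
  rw [map_add, map_mul, map_mul, LinearMap.add_apply, mul_apply, mul_apply, h0, pow_one, h.2.1] at this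
  simpa using this.symm

/-- As `r` is coprime to `X - μ`, it has an inverse `a` modulo `(X - μ) ^ (k + 1)`. Going down the
chain from `x` then means applying `a * (X - μ)`. -/
theorem exists_isTwistedChain (hr : r.eval μ ≠ 0) {x : V}
    (hx : x ∈ f.genEigenspace μ (k + 1 : ℕ)) (hx' : x ∉ f.genEigenspace μ k) :
    ∃ g : Fin (k + 1) → V, IsTwistedChain (aeval f (X - C μ)) (aeval f r) g ∧
      g (Fin.last k) = x := by
  rw [mem_genEigenspace_iff_aeval] at hx hx'
  obtain ⟨a, b, hab⟩ := isCoprime_of_eval_ne_zero hr (k + 1)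
  have hinv : aeval f (a * r) x = x := by
    have := congr(aeval f $hab x)
    rw [map_add, map_mul _ b, LinearMap.add_apply, mul_apply _ _ x, hx] at this
    simpa using this
  have hinv' : ∀ i, aeval f ((a * r) ^ i) x = x := by
    intro i
    induction i with
    | zero => simp
    | succ i ih => rw [pow_succ, map_mul, mul_apply, hinv, ih]
  refine ⟨fun j => aeval f ((a * (X - C μ)) ^ (k - j : ℕ)) x, ⟨?_, ?_, ?_⟩, by simp⟩
  · intro h0
    apply hx'
    have h1 := congr(aeval f (r ^ k) $h0)
    rw [← mul_apply, ← map_mul, map_zero] at h1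
    have h2 : r ^ k * (a * (X - C μ)) ^ (k - ((0 : Fin (k + 1)) : ℕ)) =
        (X - C μ) ^ k * (a * r) ^ k := by
      simp only [Fin.val_zero, Nat.sub_zero, mul_pow]; ring
    rw [h2, map_mul, mul_apply, hinv'] at h1
    exact h1
  · rw [← mul_apply, ← map_mul]
    have h2 : (X - C μ) * (a * (X - C μ)) ^ (k - ((0 : Fin (k + 1)) : ℕ)) =
        a ^ k * (X - C μ) ^ (k + 1) := by
      simp only [Fin.val_zero, Nat.sub_zero, mul_pow]; ring
    rw [h2, map_mul, mul_apply, hx, map_zero]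
  · intro j
    rw [← mul_apply, ← map_mul, ← mul_apply, ← map_mul]
    obtain ⟨i, hi⟩ : ∃ i, k = j + (i + 1) := ⟨k - j - 1, by omega⟩
    have h1 : k - (j.succ : ℕ) = i := by simp; omega
    have h2 : k - (j.castSucc : ℕ) = i + 1 := by simp; omega
    rw [h1, h2]
    have h3 : r * (a * (X - C μ)) ^ (i + 1) = ((X - C μ) * (a * (X - C μ)) ^ i) * (a * r) := by ring
    rw [h3, map_mul _ _ (a * r), mul_apply _ (aeval f (a * r)), hinv]

theorem span_isTwistedChain (hr : r.eval μ ≠ 0) :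
    Submodule.span K {x | ∃ (k : ℕ) (g : Fin (k + 1) → V),
      IsTwistedChain (aeval f (X - C μ)) (aeval f r) g ∧ ∃ j, x = g j} =
      f.maxGenEigenspace μ := by
  apply le_antisymm
  · rw [Submodule.span_le]
    rintro _ ⟨k, g, hg, j, rfl⟩
    exact f.genEigenspace_le_maximal μ _ (hg.mem_genEigenspace j)
  · intro x hx
    by_cases hx0 : x = 0
    · rw [hx0]; exact Submodule.zero_mem _
    have hex : ∃ k : ℕ, x ∈ f.genEigenspace μ k := by
      rw [mem_maxGenEigenspace] at hx
      obtain ⟨k, hk⟩ := hx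
      exact ⟨k, by rwa [mem_genEigenspace_nat, LinearMap.mem_ker]⟩
    classical
    have hmin : ∀ k, k < Nat.find hex → x ∉ f.genEigenspace μ k := fun k hk => Nat.find_min hex hk
    have hspec := Nat.find_spec hex
    rcases hk : Nat.find hex with _ | k
    · rw [hk] at hspec; simp at hspec; contradiction
    · rw [hk] at hspec hmin
      obtain ⟨g, hg, hgx⟩ := exists_isTwistedChain hr hspec (hmin k k.lt_succ_self)
      exact Submodule.subset_span ⟨k, g, hg, Fin.last k, hgx.symm⟩

/-- The `j`-th element of a twisted chain lies in exactly the `(j + 1)`-st step of the chain of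
kernels, so lengths are bounded by the index where the kernels stabilize, and a vector new in that
last step attains the bound. -/
theorem sSup_length_isTwistedChain [FiniteDimensional K V] (hr : r.eval μ ≠ 0) :
    sSup {m | ∃ (k : ℕ) (g : Fin (k + 1) → V),
      IsTwistedChain (aeval f (X - C μ)) (aeval f r) g ∧ m = k + 1} =
      (minpoly K f).rootMultiplicity μ := by
  set S := {m | ∃ (k : ℕ) (g : Fin (k + 1) → V),
      IsTwistedChain (aeval f (X - C μ)) (aeval f r) g ∧ m = k + 1} with hS
  have hub : (minpoly K f).rootMultiplicity μ ∈ upperBounds S := by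
    rintro _ ⟨k, g, hg, rfl⟩
    by_contra! hlt
    apply hg.notMem_genEigenspace hr (Fin.last k)
    have h1 := f.genEigenspace_le_maximal μ _ (hg.mem_genEigenspace (Fin.last k))
    rw [maxGenEigenspace_eq_genEigenspace_rootMultiplicity] at h1
    refine (f.genEigenspace μ).monotone ?_ h1
    rw [Fin.val_last]
    exact_mod_cast (by omega)
  rcases hk : (minpoly K f).rootMultiplicity μ with _ | k
  · rw [hk] at hub
    exact Nat.le_zero.1 (csSup_le' hub)
  · obtain ⟨x, hx, hx'⟩ := exists_mem_genEigenspace_notMem hk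
    obtain ⟨g, hg, -⟩ := exists_isTwistedChain hr hx hx'
    rw [hk] at hub
    exact IsGreatest.csSup_eq ⟨⟨k, g, hg, rfl⟩, hub⟩

end Module.End

/-! ### The pencil seen through its resolvent and a chart of the sphere -/

namespace MatrixPencil

noncomputable section

open Module Matrix

variable {n : ℕ}

/-- The matrix `(γ E - A)⁻¹ E`. -/
def resolvent (P : MatrixPencil n) (γ : ℂ) : Matrix (Fin n) (Fin n) ℂ :=
  (γ • P.E - P.A)⁻¹ * P.E

/-- The chart `z ↦ (γ - z)⁻¹`, `∞ ↦ 0` of the Riemann sphere away from `γ`. -/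
def chart (γ : ℂ) : OnePoint ℂ → ℂ
  | ∞ => 0
  | (z : ℂ) => (γ - z)⁻¹

@[simp] theorem chart_infty (γ : ℂ) : chart γ ∞ = 0 := rfl

@[simp] theorem chart_coe (γ z : ℂ) : chart γ (z : OnePoint ℂ) = (γ - z)⁻¹ := rfl

theorem chart_injOn (γ : ℂ) {lam lam' : OnePoint ℂ} (h : lam ≠ γ) (h' : lam' ≠ γ)
    (heq : chart γ lam = chart γ lam') : lam = lam' := by
  induction lam using OnePoint.rec with
  | infty =>
    induction lam' using OnePoint.rec with
    | infty => rfl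
    | coe w =>
      have hw : γ - w ≠ 0 := fun h0 => h' (by rw [sub_eq_zero.1 h0])
      exact absurd heq.symm (inv_ne_zero hw)
  | coe z =>
    have hz : γ - z ≠ 0 := fun h0 => h (by rw [sub_eq_zero.1 h0])
    induction lam' using OnePoint.rec with
    | infty => exact absurd heq (inv_ne_zero hz)
    | coe w => simpa using heq

theorem exists_chart_eq (γ t : ℂ) : ∃ lam : OnePoint ℂ, lam ≠ γ ∧ chart γ lam = t := by
  by_cases ht : t = 0
  · exact ⟨∞, OnePoint.infty_ne_coe γ, ht.symm⟩
  · refine ⟨((γ - t⁻¹ : ℂ) : OnePoint ℂ), ?_, by simp⟩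
    rw [Ne, OnePoint.coe_eq_coe]
    simpa using ht

/-- The polynomial by which the chains of the pencil are twisted in the chart. -/
def chartTwist (γ : ℂ) : OnePoint ℂ → ℂ[X]
  | ∞ => C γ * X - 1
  | (z : ℂ) => C (γ - z)⁻¹ * X

theorem chartTwist_eval_ne_zero {γ : ℂ} {lam : OnePoint ℂ} (h : lam ≠ γ) :
    (chartTwist γ lam).eval (chart γ lam) ≠ 0 := by
  induction lam using OnePoint.rec with
  | infty => simp [chartTwist]
  | coe z =>
    have hz : γ - z ≠ 0 := fun h0 => h (by rw [sub_eq_zero.1 h0])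
    simp [chartTwist, hz]

variable {P : MatrixPencil n} {γ : ℂ}

theorem mul_resolvent (hB : IsUnit (γ • P.E - P.A)) : (γ • P.E - P.A) * P.resolvent γ = P.E := by
  rw [resolvent, ← mul_assoc, mul_nonsing_inv _ ((isUnit_iff_isUnit_det _).1 hB), one_mul]

theorem A_eq (hB : IsUnit (γ • P.E - P.A)) :
    P.A = (γ • P.E - P.A) * (γ • P.resolvent γ - 1) := by
  rw [mul_sub, mul_smul_comm, mul_resolvent hB, mul_one, sub_sub_cancel]

theorem A_sub_smul_E_eq (hB : IsUnit (γ • P.E - P.A)) {z : ℂ} (hz : γ - z ≠ 0) :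
    P.A - z • P.E = (γ - z) • ((γ • P.E - P.A) * (P.resolvent γ - (γ - z)⁻¹ • 1)) := by
  rw [mul_sub, mul_resolvent hB, smul_sub, mul_smul_comm, smul_smul, mul_inv_cancel₀ hz, one_smul,
    mul_one, sub_smul]
  abel

theorem mulVec_injective (hB : IsUnit (γ • P.E - P.A)) :
    Function.Injective (γ • P.E - P.A).mulVec :=
  mulVec_injective_iff_isUnit.2 hB

/-- With `B = γE - A` and `N` the resolvent, `E = B N`, `A = B (γN - 1)` and `A - zE = (γ - z) B (N
- (γ - z)⁻¹)`. Cancelling the injective `B`, and `γ - z` at finite points, leaves relations in `N`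
alone. -/
theorem isJordanChain_iff (hB : IsUnit (γ • P.E - P.A)) {lam : OnePoint ℂ} (h : lam ≠ γ) {k : ℕ}
    (g : Fin (k + 1) → Fin n → ℂ) :
    P.IsJordanChain lam g ↔
      End.IsTwistedChain (aeval (toLin' (P.resolvent γ)) (X - C (chart γ lam)))
        (aeval (toLin' (P.resolvent γ)) (chartTwist γ lam)) g := by
  have hinj := mulVec_injective hB
  induction lam using OnePoint.rec with
  | infty =>
    have hE : ∀ x, P.E *ᵥ x = (γ • P.E - P.A) *ᵥ (P.resolvent γ *ᵥ x) := fun x => by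
      rw [mulVec_mulVec, mul_resolvent hB]
    have hA : ∀ x, P.A *ᵥ x = (γ • P.E - P.A) *ᵥ (γ • (P.resolvent γ *ᵥ x) - x) := fun x => by
      conv_lhs => rw [A_eq hB]
      rw [← mulVec_mulVec, sub_mulVec _ 1, one_mulVec, smul_mulVec]
    have h1 : ∀ x, P.E *ᵥ x = 0 ↔ P.resolvent γ *ᵥ x = 0 := fun x => by
      rw [hE, ← hinj.eq_iff (b := 0) (a := P.resolvent γ *ᵥ x), mulVec_zero]
    have h2 : ∀ x y, P.E *ᵥ x = P.A *ᵥ y ↔ P.resolvent γ *ᵥ x = γ • (P.resolvent γ *ᵥ y) - y :=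
      fun x y => by rw [hE, hA, hinj.eq_iff]
    change (_ ∧ _ ∧ _) ↔ (_ ∧ _ ∧ _)
    simp [h1, h2, chartTwist]
  | coe z =>
    have hz : γ - z ≠ 0 := fun h0 => h (by rw [sub_eq_zero.1 h0])
    have hE : ∀ x, P.E *ᵥ x = (γ - z) • (γ • P.E - P.A) *ᵥ ((γ - z)⁻¹ • P.resolvent γ *ᵥ x) :=
      fun x => by
        rw [mulVec_smul, smul_smul, mul_inv_cancel₀ hz, one_smul, mulVec_mulVec, mul_resolvent hB]
    have hA : ∀ x, (P.A - z • P.E) *ᵥ x =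
        (γ - z) • (γ • P.E - P.A) *ᵥ (P.resolvent γ *ᵥ x - (γ - z)⁻¹ • x) := fun x => by
      rw [A_sub_smul_E_eq hB hz, smul_mulVec, ← mulVec_mulVec, sub_mulVec _ (_ • 1), smul_mulVec,
        one_mulVec]
    have h1 : ∀ x, (P.A - z • P.E) *ᵥ x = 0 ↔ P.resolvent γ *ᵥ x - (γ - z)⁻¹ • x = 0 := fun x => by
      rw [hA, smul_eq_zero_iff_right hz,
        ← hinj.eq_iff (b := 0) (a := P.resolvent γ *ᵥ x - (γ - z)⁻¹ • x), mulVec_zero]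
    have h2 : ∀ x y, (P.A - z • P.E) *ᵥ x = P.E *ᵥ y ↔
        P.resolvent γ *ᵥ x - (γ - z)⁻¹ • x = (γ - z)⁻¹ • P.resolvent γ *ᵥ y :=
      fun x y => by rw [hE, hA, (smul_right_injective _ hz).eq_iff, hinj.eq_iff]
    change (_ ∧ _ ∧ _) ↔ (_ ∧ _ ∧ _)
    simp [h1, h2, chartTwist]

theorem rootDim_eq (hB : IsUnit (γ • P.E - P.A)) {lam : OnePoint ℂ} (h : lam ≠ γ) :
    P.rootDim lam = (P.resolvent γ).charpoly.rootMultiplicity (chart γ lam) := by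
  have hroot : P.rootSubspace lam =
      End.maxGenEigenspace (toLin' (P.resolvent γ)) (chart γ lam) := by
    rw [← End.span_isTwistedChain (chartTwist_eval_ne_zero h), rootSubspace]
    simp_rw [isJordanChain_iff hB h]
  rw [rootDim, hroot, LinearMap.finrank_maxGenEigenspace_eq, charpoly_toLin']

theorem longestChain_eq (hB : IsUnit (γ • P.E - P.A)) {lam : OnePoint ℂ} (h : lam ≠ γ) :
    P.longestChain lam = (minpoly ℂ (P.resolvent γ)).rootMultiplicity (chart γ lam) := by
  have := End.sSup_length_isTwistedChain (f := toLin' (P.resolvent γ)) (chartTwist_eval_ne_zero h)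
  rw [longestChain]
  simp_rw [isJordanChain_iff hB h]
  rw [this, minpoly_toLin']

theorem dimKer_eq (hB : IsUnit (γ • P.E - P.A)) {lam : OnePoint ℂ} (h : lam ≠ γ) :
    P.dimKer lam = finrank ℂ (End.eigenspace (toLin' (P.resolvent γ)) (chart γ lam)) := by
  have hinj := mulVec_injective hB
  suffices LinearMap.ker (toLin' (P.eval lam)) =
      End.eigenspace (toLin' (P.resolvent γ)) (chart γ lam) by rw [dimKer, this]
  ext x
  rw [LinearMap.mem_ker, toLin'_apply, End.mem_eigenspace_iff, toLin'_apply]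
  induction lam using OnePoint.rec with
  | infty =>
    change P.E *ᵥ x = 0 ↔ _
    rw [← mul_resolvent hB, ← mulVec_mulVec, ← mulVec_zero (γ • P.E - P.A), hinj.eq_iff]
    simp
  | coe z =>
    have hz : γ - z ≠ 0 := fun h0 => h (by rw [sub_eq_zero.1 h0])
    change (z • P.E - P.A) *ᵥ x = 0 ↔ _
    rw [← neg_sub, A_sub_smul_E_eq hB hz, neg_mulVec, neg_eq_zero, smul_mulVec,
      smul_eq_zero_iff_right hz, ← mulVec_mulVec, ← mulVec_zero (γ • P.E - P.A), hinj.eq_iff,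
      sub_mulVec, smul_mulVec, one_mulVec, sub_eq_zero, chart_coe]

theorem mem_spec_iff_dimKer (P : MatrixPencil n) (lam : OnePoint ℂ) :
    lam ∈ P.spec ↔ 0 < P.dimKer lam := by
  rw [dimKer, Nat.pos_iff_ne_zero, Ne, Submodule.finrank_eq_zero]
  induction lam using OnePoint.rec with
  | infty =>
    change ¬ IsUnit P.E ↔ ¬ LinearMap.ker (toLin' P.E) = ⊥
    rw [LinearMap.ker_eq_bot, ← mulVec_injective_iff_isUnit]
    rfl
  | coe z =>
    change End.HasEigenvalue (toLin' (z • P.E - P.A)) 0 ↔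
      ¬ LinearMap.ker (toLin' (z • P.E - P.A)) = ⊥
    rw [End.hasEigenvalue_iff, End.eigenspace_zero]

theorem mem_spec_iff (hB : IsUnit (γ • P.E - P.A)) {lam : OnePoint ℂ} (h : lam ≠ γ) :
    lam ∈ P.spec ↔ (P.resolvent γ).charpoly.IsRoot (chart γ lam) := by
  rw [mem_spec_iff_dimKer, dimKer_eq hB h, Nat.pos_iff_ne_zero, Ne, Submodule.finrank_eq_zero,
    ← Ne, ← End.hasEigenvalue_iff, End.hasEigenvalue_iff_isRoot_charpoly, charpoly_toLin']

theorem two_le_dimKer_iff (hB : IsUnit (γ • P.E - P.A)) {lam : OnePoint ℂ} (h : lam ≠ γ) :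
    2 ≤ P.dimKer lam ↔ P.longestChain lam < P.rootDim lam := by
  rw [dimKer_eq hB h, End.two_le_finrank_eigenspace_iff, longestChain_eq hB h, rootDim_eq hB h,
    minpoly_toLin', charpoly_toLin']

theorem notMem_spec_of_isUnit (hB : IsUnit (γ • P.E - P.A)) : (γ : OnePoint ℂ) ∉ P.spec := by
  rw [mem_spec_iff_dimKer, dimKer, not_lt, Nat.le_zero, Submodule.finrank_eq_zero,
    LinearMap.ker_eq_bot]
  exact mulVec_injective hB

theorem rootDim_eq_zero_of_isUnit (hB : IsUnit (γ • P.E - P.A)) : P.rootDim γ = 0 := by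
  rw [rootDim, Submodule.finrank_eq_zero, rootSubspace, Submodule.span_eq_bot]
  rintro x ⟨k, g, hg, -⟩
  refine absurd (mulVec_injective hB ?_) hg.1
  rw [mulVec_zero, ← neg_sub, neg_mulVec]
  exact neg_eq_zero.2 hg.2.1

theorem eval_det_poly (P : MatrixPencil n) (z : ℂ) :
    P.poly.det.eval z = (z • P.E - P.A).det := by
  rw [← coe_evalRingHom, RingHom.map_det]
  congr 1
  ext i j
  simp [poly]
  ring

theorem isRegular_of_isUnit (hB : IsUnit (γ • P.E - P.A)) : P.IsRegular := by
  intro h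
  have h1 := ((isUnit_iff_isUnit_det _).1 hB).ne_zero
  rw [← eval_det_poly, h, eval_zero] at h1
  exact h1 rfl

/-- The chart matches the spectrum with the roots of the minimal polynomial, whose multiplicities
add up to its degree because it splits over `ℂ`. -/
theorem sumLongestChains_eq (hB : IsUnit (γ • P.E - P.A)) :
    P.sumLongestChains = (minpoly ℂ (P.resolvent γ)).natDegree := by
  set q := minpoly ℂ (P.resolvent γ) with hq
  have hq0 : q ≠ 0 := (P.resolvent γ).minpoly_monic.ne_zero
  have hroot : ∀ t, q.IsRoot t ↔ (P.resolvent γ).charpoly.IsRoot t := fun t => by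
    rw [hq, ← minpoly_toLin', ← charpoly_toLin', ← End.hasEigenvalue_iff_isRoot,
      End.hasEigenvalue_iff_isRoot_charpoly]
  have hne : ∀ lam ∈ P.spec, lam ≠ γ := by
    rintro _ h rfl; exact notMem_spec_of_isUnit hB h
  have hbij : Set.BijOn (chart γ) P.spec (q.roots.toFinset : Set ℂ) := by
    refine ⟨fun lam h => ?_, fun lam h lam' h' => chart_injOn γ (hne _ h) (hne _ h'), fun t ht => ?_⟩
    · rw [Finset.mem_coe, Multiset.mem_toFinset, mem_roots hq0, hroot]
      exact (mem_spec_iff hB (hne _ h)).1 h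
    · rw [Finset.mem_coe, Multiset.mem_toFinset, mem_roots hq0, hroot] at ht
      obtain ⟨lam, hlam, rfl⟩ := exists_chart_eq γ t
      exact ⟨lam, (mem_spec_iff hB hlam).2 ht, rfl⟩
  rw [sumLongestChains, finsum_mem_eq_of_bijOn (chart γ) hbij
    (g := fun t => q.rootMultiplicity t) fun lam h => longestChain_eq hB (hne _ h),
    finsum_mem_coe_finset]
  simp_rw [← count_roots]
  rw [Multiset.toFinset_sum_count_eq]
  exact (splits_iff_card_roots.1 (IsAlgClosed.splits q))

end

end MatrixPencil

/-! ### The target polynomial and the placement criterion -/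

namespace MatrixPencil

noncomputable section

open Module Matrix

variable {n : ℕ}

theorem rootMultiplicity_prod_X_sub_C_pow {ι : Type*} (s : Finset ι) (a : ι → ℂ) (m : ι → ℕ)
    (t : ℂ) : (∏ i ∈ s, (X - C (a i)) ^ m i).rootMultiplicity t =
      ∑ i ∈ s, if a i = t then m i else 0 := by
  classical
  have hne : ∀ i, (X - C (a i)) ^ m i ≠ 0 := fun i => pow_ne_zero _ (X_sub_C_ne_zero _)
  rw [← count_roots, roots_prod _ _ (Finset.prod_ne_zero_iff.2 fun i _ => hne i),
    Multiset.count_bind]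
  refine Finset.sum_congr rfl fun i _ => ?_
  rw [roots_pow, roots_X_sub_C, Multiset.count_nsmul, Multiset.count_singleton]
  simp [eq_comm]

variable {P Q : MatrixPencil n} {γ : ℂ} {l : ℕ} {μ : Fin l → OnePoint ℂ} {m : Fin l → ℕ}

/-- The polynomial whose roots are the prescribed points in the chart around infinity. -/
def targetPoly (γ : ℂ) (μ : Fin l → OnePoint ℂ) (m : Fin l → ℕ) : ℂ[X] :=
  ∏ i, (X - C (chart γ (μ i))) ^ m i

theorem targetPoly_monic (γ : ℂ) (μ : Fin l → OnePoint ℂ) (m : Fin l → ℕ) :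
    (targetPoly γ μ m).Monic :=
  monic_prod_of_monic _ _ fun _ _ => (monic_X_sub_C _).pow _

theorem natDegree_targetPoly (γ : ℂ) (μ : Fin l → OnePoint ℂ) (m : Fin l → ℕ) :
    (targetPoly γ μ m).natDegree = ∑ i, m i := by
  rw [targetPoly, natDegree_prod_of_monic _ _ fun _ _ => (monic_X_sub_C _).pow _]
  simp [(monic_X_sub_C _).natDegree_pow]

theorem rootMultiplicity_targetPoly (hμ : Function.Injective μ) (hγ : ∀ i, μ i ≠ γ) (i : Fin l) :
    (targetPoly γ μ m).rootMultiplicity (chart γ (μ i)) = m i := by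
  rw [targetPoly, rootMultiplicity_prod_X_sub_C_pow, Finset.sum_eq_single i]
  · simp
  · intro j _ hj
    rw [if_neg fun h => hj (hμ (chart_injOn γ (hγ j) (hγ i) h))]
  · simp

theorem rootMultiplicity_targetPoly_of_notMem (hγ : ∀ i, μ i ≠ γ) {lam : OnePoint ℂ}
    (hlam : lam ≠ γ) (h : lam ∉ Set.range μ) :
    (targetPoly γ μ m).rootMultiplicity (chart γ lam) = 0 := by
  rw [targetPoly, rootMultiplicity_prod_X_sub_C_pow]
  refine Finset.sum_eq_zero fun i _ => ?_
  rw [if_neg fun h' => h ⟨i, chart_injOn γ (hγ i) hlam h'⟩]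

theorem mem_spec_iff_rootDim_pos (hB : IsUnit (γ • P.E - P.A)) {lam : OnePoint ℂ} (h : lam ≠ γ) :
    lam ∈ P.spec ↔ 0 < P.rootDim lam := by
  rw [mem_spec_iff hB h, rootDim_eq hB h, rootMultiplicity_pos (charpoly_monic _).ne_zero]

theorem longestChain_le_rootDim (hB : IsUnit (γ • P.E - P.A)) {lam : OnePoint ℂ} (h : lam ≠ γ) :
    P.longestChain lam ≤ P.rootDim lam := by
  rw [longestChain_eq hB h, rootDim_eq hB h]
  exact rootMultiplicity_le_rootMultiplicity_of_dvd (charpoly_monic _).ne_zero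
    (minpoly_dvd_charpoly _) _

theorem rootDim_add_longestChain (hB : IsUnit (γ • P.E - P.A)) (hB' : IsUnit (γ • Q.E - Q.A))
    (h : (Q.resolvent γ).charpoly * minpoly ℂ (P.resolvent γ) =
      targetPoly γ μ m * (P.resolvent γ).charpoly) {lam : OnePoint ℂ} (hlam : lam ≠ γ) :
    Q.rootDim lam + P.longestChain lam =
      (targetPoly γ μ m).rootMultiplicity (chart γ lam) + P.rootDim lam := by
  rw [rootDim_eq hB hlam, rootDim_eq hB' hlam, longestChain_eq hB hlam, ← rootMultiplicity_mul,
    ← rootMultiplicity_mul, h]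
  · exact mul_ne_zero (targetPoly_monic _ _ _).ne_zero (charpoly_monic _).ne_zero
  · exact mul_ne_zero (charpoly_monic _).ne_zero (minpoly_monic _).ne_zero

/-- The placement property in terms of characteristic polynomials of resolvents. -/
theorem isPlacement_of_charpoly (hB : IsUnit (γ • P.E - P.A)) (hB' : IsUnit (γ • Q.E - Q.A))
    (hμ : Function.Injective μ) (hγ : ∀ i, μ i ≠ γ) (hm : ∀ i, 0 < m i)
    (h : (Q.resolvent γ).charpoly * minpoly ℂ (P.resolvent γ) =
      targetPoly γ μ m * (P.resolvent γ).charpoly) :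
    P.IsPlacement Q μ m := by
  have key := fun {lam : OnePoint ℂ} (hlam : lam ≠ γ) =>
    rootDim_add_longestChain hB hB' h hlam
  have hle := fun {lam : OnePoint ℂ} (hlam : lam ≠ γ) => longestChain_le_rootDim hB hlam
  have hspec := fun {lam : OnePoint ℂ} (hlam : lam ≠ γ) => mem_spec_iff_rootDim_pos hB hlam
  have hne : ∀ lam ∈ P.spec, lam ≠ γ := by
    rintro _ h rfl; exact notMem_spec_of_isUnit hB h
  refine ⟨?_, fun i hi => ?_, fun lam h1 h2 => ?_, fun i hi => ?_, fun lam h1 h2 => ?_⟩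
  · ext lam
    -- The chart misses `γ`, but `γ` is an eigenvalue of neither pencil and not a target.
    by_cases hlam : lam = γ
    · subst hlam
      simp only [notMem_spec_of_isUnit hB', Set.mem_union, Set.mem_ofPred_eq,
        notMem_spec_of_isUnit hB, false_and, or_false, false_iff]
      rintro ⟨i, hi⟩
      exact hγ i hi
    · rw [mem_spec_iff_rootDim_pos hB' hlam, Set.mem_union, Set.mem_ofPred_eq,
        two_le_dimKer_iff hB hlam, hspec hlam]
      have h1 := key hlam
      have h2 := hle hlam
      by_cases hr : lam ∈ Set.range μ
      · obtain ⟨i, rfl⟩ := hr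
        rw [rootMultiplicity_targetPoly hμ hγ] at h1
        have := hm i
        simp only [Set.mem_range_self, true_or, iff_true]
        omega
      · rw [rootMultiplicity_targetPoly_of_notMem hγ hlam hr] at h1
        simp only [hr, false_or]
        omega
  · have h1 := key (hγ i)
    rw [rootMultiplicity_targetPoly hμ hγ] at h1
    omega
  · have h3 := key (hne _ h1)
    rw [rootMultiplicity_targetPoly_of_notMem hγ (hne _ h1) h2] at h3
    omega
  · have h1 := key (hγ i)
    have h2 := hle (hγ i)
    rw [hspec (hγ i)] at hi
    rw [rootMultiplicity_targetPoly hμ hγ] at h1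
    omega
  · by_cases hlam : lam = γ
    · rw [hlam]; exact rootDim_eq_zero_of_isUnit hB'
    · have h3 := key hlam
      have h4 := hle hlam
      rw [hspec hlam] at h1
      rw [rootMultiplicity_targetPoly_of_notMem hγ hlam h2] at h3
      omega

theorem rank_rankOnePencil {α β : ℂ} {u v : Fin n → ℂ} (hα : α ≠ 0) (hu : u ≠ 0) (hv : v ≠ 0) :
    (rankOnePencil α β u v).rank = 1 := by
  have hpoly : (rankOnePencil α β u v).poly =
      vecMulVec (fun i => (C α * X - C β) * C (u i)) (fun j => C (star (v j))) := by
    ext i j : 1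
    simp [poly, rankOnePencil, vecMulVec_apply]
    ring
  have hlin : C α * X - C β ≠ 0 := by
    intro h
    have := congr(($h).coeff 1)
    simp at this
    exact hα this
  obtain ⟨i, hi⟩ := Function.ne_iff.1 hu
  obtain ⟨j, hj⟩ := Function.ne_iff.1 hv
  refine IsGreatest.csSup_eq ⟨⟨fun _ => i, fun _ => j, ?_⟩, ?_⟩
  · rw [hpoly, det_fin_one, submatrix_apply, vecMulVec_apply]
    refine mul_ne_zero (mul_ne_zero hlin (C_ne_zero.2 hi)) (C_ne_zero.2 ?_)
    simpa using hj
  · rintro r ⟨f, g, hdet⟩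
    by_contra! hr
    -- A rank-one matrix has zero determinant only from size two on.
    have : Nontrivial (Fin r) := Fin.nontrivial_iff_two_le.2 hr
    apply hdet
    have hsub : ∀ a b : Fin n → ℂ[X],
        (vecMulVec a b).submatrix f g = vecMulVec (a ∘ f) (b ∘ g) := fun _ _ => rfl
    rw [hpoly, hsub, det_vecMulVec]

theorem add_rankOnePencil_E (P : MatrixPencil n) (α β : ℂ) (u v : Fin n → ℂ) :
    (P + rankOnePencil α β u v).E = P.E + α • vecMulVec u (star v) := rfl

theorem add_rankOnePencil_A (P : MatrixPencil n) (α β : ℂ) (u v : Fin n → ℂ) :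
    (P + rankOnePencil α β u v).A = P.A + β • vecMulVec u (star v) := rfl

/-- A perturbation by `(s - γ) u v^*` does not change the value of the pencil at `γ`. -/
theorem smul_E_sub_A_add_rankOnePencil (P : MatrixPencil n) (γ : ℂ) (u v : Fin n → ℂ) :
    γ • (P + rankOnePencil 1 γ u v).E - (P + rankOnePencil 1 γ u v).A = γ • P.E - P.A := by
  rw [add_rankOnePencil_E, add_rankOnePencil_A, one_smul, smul_add, add_sub_add_right_eq_sub]

theorem resolvent_add_rankOnePencil (hB : IsUnit (γ • P.E - P.A)) (u v : Fin n → ℂ) :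
    (P + rankOnePencil 1 γ ((γ • P.E - P.A) *ᵥ u) v).resolvent γ =
      P.resolvent γ + vecMulVec u (star v) := by
  rw [resolvent, smul_E_sub_A_add_rankOnePencil, add_rankOnePencil_E, one_smul, mul_add,
    mul_vecMulVec, mulVec_mulVec, nonsing_inv_mul _ ((isUnit_iff_isUnit_det _).1 hB), one_mulVec]
  rfl

theorem isRegular_and_isPlacement_add_rankOnePencil (hB : IsUnit (γ • P.E - P.A))
    (hμ : Function.Injective μ) (hγ : ∀ i, μ i ≠ γ) (hm : ∀ i, 0 < m i) {u v : Fin n → ℂ}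
    (h : (P.resolvent γ + vecMulVec u (star v)).charpoly * minpoly ℂ (P.resolvent γ) =
      targetPoly γ μ m * (P.resolvent γ).charpoly) :
    (P + rankOnePencil 1 γ ((γ • P.E - P.A) *ᵥ u) v).IsRegular ∧
      P.IsPlacement (P + rankOnePencil 1 γ ((γ • P.E - P.A) *ᵥ u) v) μ m := by
  have hB' := hB
  rw [← smul_E_sub_A_add_rankOnePencil P γ ((γ • P.E - P.A) *ᵥ u) v] at hB'
  refine ⟨isRegular_of_isUnit hB', isPlacement_of_charpoly hB hB' hμ hγ hm ?_⟩
  rw [resolvent_add_rankOnePencil hB, h]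

/-- A pencil of size one is doubled by adding the rank-one pencil that it is itself. -/
theorem isRegular_and_isPlacement_double {P : MatrixPencil 1} (hB : IsUnit (γ • P.E - P.A))
    (hμ : Function.Injective μ) (hγ : ∀ i, μ i ≠ γ) (hm : ∀ i, 0 < m i)
    (h : targetPoly γ μ m = minpoly ℂ (P.resolvent γ)) :
    (P + rankOnePencil (P.E 0 0) (P.A 0 0) 1 1).IsRegular ∧
      P.IsPlacement (P + rankOnePencil (P.E 0 0) (P.A 0 0) 1 1) μ m := by
  set Q := P + rankOnePencil (P.E 0 0) (P.A 0 0) 1 1 with hQ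
  have hE : Q.E = (2 : ℂ) • P.E := by
    ext i j
    rw [Subsingleton.elim i 0, Subsingleton.elim j 0, hQ, add_rankOnePencil_E]
    simp; ring
  have hA : Q.A = (2 : ℂ) • P.A := by
    ext i j
    rw [Subsingleton.elim i 0, Subsingleton.elim j 0, hQ, add_rankOnePencil_A]
    simp; ring
  have hQB : γ • Q.E - Q.A = (2 : ℂ) • (γ • P.E - P.A) := by
    rw [hE, hA, smul_sub, smul_comm]
  have hB' : IsUnit (γ • Q.E - Q.A) := by
    rw [hQB]
    exact (isUnit_smul_iff (Units.mk0 (2 : ℂ) two_ne_zero) _).2 hB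
  have hres : Q.resolvent γ = P.resolvent γ := by
    apply hB.mul_left_cancel
    have h2 := mul_resolvent hB'
    rw [hQB, hE, smul_mul_assoc] at h2
    rw [mul_resolvent hB]
    exact smul_right_injective _ (two_ne_zero : (2 : ℂ) ≠ 0) h2
  refine ⟨isRegular_of_isUnit hB', isPlacement_of_charpoly hB hB' hμ hγ hm ?_⟩
  rw [hres, h, mul_comm]

theorem exists_real_isUnit {P : MatrixPencil n} (hP : P.IsRegular) (μ : Fin l → OnePoint ℂ) :
    ∃ γ : ℝ, IsUnit ((γ : ℂ) • P.E - P.A) ∧ ∀ i, μ i ≠ (γ : ℂ) := by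
  have h1 : {x : ℝ | P.poly.det.IsRoot (x : ℂ)}.Finite :=
    (finite_setOfPred_isRoot hP).preimage Complex.ofReal_injective.injOn
  have h2 : {x : ℝ | ((x : ℂ) : OnePoint ℂ) ∈ Set.range μ}.Finite :=
    (Set.finite_range μ).preimage (OnePoint.coe_injective.comp Complex.ofReal_injective).injOn
  obtain ⟨γ, hγ⟩ := (h1.union h2).infinite_compl.nonempty
  rw [Set.mem_compl_iff, Set.mem_union, not_or] at hγ
  refine ⟨γ, ?_, fun i hi => hγ.2 ⟨i, hi⟩⟩
  rw [isUnit_iff_isUnit_det, ← eval_det_poly]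
  exact Ne.isUnit hγ.1

theorem isRoot_targetPoly (γ : ℂ) (μ : Fin l → OnePoint ℂ) (hm : ∀ i, 0 < m i) (i : Fin l) :
    (targetPoly γ μ m).IsRoot (chart γ (μ i)) := by
  rw [targetPoly, IsRoot, eval_prod]
  exact Finset.prod_eq_zero (Finset.mem_univ i) (by simp [(hm i).ne'])

theorem mem_spec_of_targetPoly_eq_minpoly (hB : IsUnit (γ • P.E - P.A)) (hγ : ∀ i, μ i ≠ γ)
    (hm : ∀ i, 0 < m i) (h : targetPoly γ μ m = minpoly ℂ (P.resolvent γ)) (i : Fin l) :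
    μ i ∈ P.spec := by
  rw [mem_spec_iff hB (hγ i)]
  exact (isRoot_targetPoly γ μ hm i).dvd (h ▸ minpoly_dvd_charpoly (P.resolvent γ))

/-- If `E = 0` the resolvent vanishes and its minimal polynomial is `X`; the root `0` is the chart
value of `∞`. -/
theorem exists_target_eq_infty {P : MatrixPencil n} (hn : n ≠ 0)
    (hγ : ∀ i, μ i ≠ γ) (hE : P.E = 0)
    (h : targetPoly γ μ m = minpoly ℂ (P.resolvent γ)) : ∃ i, μ i = ∞ := by
  have : NeZero n := ⟨hn⟩
  have hres : P.resolvent γ = 0 := by rw [resolvent, hE, mul_zero]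
  rw [hres, minpoly.zero] at h
  have h0 : (targetPoly γ μ m).eval 0 = 0 := by rw [h, eval_X]
  rw [targetPoly, eval_prod, Finset.prod_eq_zero_iff] at h0
  obtain ⟨i, -, hi⟩ := h0
  refine ⟨i, chart_injOn γ (hγ i) (OnePoint.infty_ne_coe γ) ?_⟩
  rw [eval_pow] at hi
  simpa using eq_zero_of_pow_eq_zero hi

theorem minpoly_not_isUnit {F : Type*} [Field F] (hn : n ≠ 0) (N : Matrix (Fin n) (Fin n) F) :
    ¬ IsUnit (minpoly F N) := by
  have : NeZero n := ⟨hn⟩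
  exact minpoly.not_isUnit F N

end

end MatrixPencil

/-! ### The complex and the real placement -/

namespace MatrixPencil

noncomputable section

open Module Matrix

variable {n : ℕ} {P : MatrixPencil n} {γ : ℂ} {l : ℕ} {μ : Fin l → OnePoint ℂ} {m : Fin l → ℕ}

theorem mulVec_ne_zero (hB : IsUnit (γ • P.E - P.A)) {u : Fin n → ℂ} (hu : u ≠ 0) :
    (γ • P.E - P.A) *ᵥ u ≠ 0 := fun h =>
  hu (mulVec_injective hB (by rw [h, mulVec_zero]))

theorem exists_complex_placement (P : MatrixPencil n) (hP : P.IsRegular) (hμ : Function.Injective μ)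
    (hm : ∀ i, 0 < m i) (hsum : ∑ i, m i = P.sumLongestChains) :
    ∃ (α β : ℂ) (u v : Fin n → ℂ), α ≠ 0 ∧
      (P + rankOnePencil α β u v).IsRegular ∧
      P.IsPlacement (P + rankOnePencil α β u v) μ m ∧
      (n ≠ 0 → (n = 1 → ∀ i, μ i ∈ P.spec → μ i ≠ ∞) →
        (rankOnePencil α β u v).rank = 1) := by
  obtain ⟨γ, hB, hγ⟩ := exists_real_isUnit hP μ
  -- For `n = 1` a nonzero perturbation vanishing at `γ` always moves the eigenvalue. To keep it,
  -- the pencil is doubled instead; `α = E ≠ 0` is then required.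
  by_cases hdouble : n = 1 ∧ targetPoly γ μ m = minpoly ℂ (P.resolvent γ) ∧ P.E ≠ 0
  · obtain ⟨rfl, hp, hE⟩ := hdouble
    have hE0 : P.E 0 0 ≠ 0 := fun h => hE (by
      ext i j; rw [Subsingleton.elim i 0, Subsingleton.elim j 0, h]; rfl)
    obtain ⟨hreg, hpl⟩ := isRegular_and_isPlacement_double hB hμ hγ hm hp
    exact ⟨_, _, 1, 1, hE0, hreg, hpl, fun _ _ => rank_rankOnePencil hE0 one_ne_zero one_ne_zero⟩
  obtain ⟨u, v, heq, hne⟩ := exists_charpoly_add_vecMulVec (P.resolvent γ)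
    (targetPoly_monic γ μ m) (by rw [natDegree_targetPoly, hsum, sumLongestChains_eq hB])
  obtain ⟨hreg, hpl⟩ := isRegular_and_isPlacement_add_rankOnePencil (v := star v) hB hμ hγ hm
    (by rwa [star_star])
  refine ⟨1, γ, _, _, one_ne_zero, hreg, hpl, fun hn h1 => ?_⟩
  obtain ⟨hu, hv⟩ := hne fun hp => by
    -- Over `ℂ` an irreducible factor is linear, so its degree is below `n` unless `n = 1`.
    obtain ⟨f, hf, hdvd⟩ := WfDvdMonoid.exists_irreducible_factor
      (minpoly_not_isUnit hn (P.resolvent γ)) (minpoly_monic _).ne_zero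
    refine ⟨f, hdvd, hf.not_isUnit, ?_⟩
    have hf1 : f.natDegree = 1 :=
      natDegree_eq_of_degree_eq_some (IsAlgClosed.degree_eq_one_of_irreducible ℂ hf)
    rw [hf1]
    by_contra! hlt
    have hn1 : n = 1 := by omega
    have hE : P.E = 0 := by
      by_contra hE
      exact hdouble ⟨hn1, hp, hE⟩
    obtain ⟨i, hi⟩ := exists_target_eq_infty hn hγ hE hp
    exact h1 hn1 i (mem_spec_of_targetPoly_eq_minpoly hB hγ hm hp i) hi
  exact rank_rankOnePencil one_ne_zero (mulVec_ne_zero hB hu) (star_ne_zero.2 hv)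

theorem exists_map_ofReal_eq {p : ℂ[X]} (hp : p.map (starRingEnd ℂ) = p) :
    ∃ p₀ : ℝ[X], p₀.map Complex.ofRealHom = p := by
  have : p ∈ lifts Complex.ofRealHom := by
    rw [lifts_iff_coeff_lifts]
    intro k
    have h := congr(($hp).coeff k)
    rw [coeff_map] at h
    exact Complex.conj_eq_iff_real.1 h |>.imp fun _ h => h.symm
  simpa [lifts, RingHom.mem_rangeS] using this

theorem aeval_map_matrix {R S : Type*} [CommRing R] [CommRing S] (φ : R →+* S)
    (N : Matrix (Fin n) (Fin n) R) (f : R[X]) :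
    aeval (N.map φ) (f.map φ) = (aeval N f).map φ := by
  refine (map_aeval_eq_aeval_map (φ := φ) (ψ := φ.mapMatrix) ?_ f N).symm
  ext a i j
  simp [algebraMap_matrix_apply, apply_ite φ]

/-- The minimal polynomial of a real matrix is also its minimal polynomial over `ℂ`. -/
theorem minpoly_map_ofReal (N : Matrix (Fin n) (Fin n) ℝ) :
    (minpoly ℝ N).map Complex.ofRealHom = minpoly ℂ (N.map Complex.ofRealHom) := by
  set q := minpoly ℂ (N.map Complex.ofRealHom) with hq
  have hqm : q.Monic := minpoly_monic _
  have hdvd : q ∣ (minpoly ℝ N).map Complex.ofRealHom :=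
    minpoly.dvd _ _ (by rw [aeval_map_matrix, minpoly.aeval, Matrix.map_zero _ (map_zero _)])
  have hconj : q.map (starRingEnd ℂ) = q := by
    have hN : (N.map Complex.ofRealHom).map (starRingEnd ℂ) = N.map Complex.ofRealHom := by
      ext i j; simp
    -- The conjugate of `q` also annihilates the real matrix and is monic of the same degree, so it
    -- equals `q`.
    refine eq_of_monic_of_dvd_of_natDegree_le hqm (hqm.map _) (minpoly.dvd _ _ ?_)
      (natDegree_map _).le
    rw [← hN, aeval_map_matrix, hq, minpoly.aeval, Matrix.map_zero _ (map_zero _)]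
  obtain ⟨q₀, hq₀⟩ := exists_map_ofReal_eq hconj
  have h0 : aeval N q₀ = 0 := by
    have h1 := aeval_map_matrix Complex.ofRealHom N q₀
    rw [hq₀, hq, minpoly.aeval] at h1
    ext i j
    simpa using (congrFun₂ h1 i j).symm
  have hdvd' : (minpoly ℝ N).map Complex.ofRealHom ∣ q :=
    hq₀ ▸ Polynomial.map_dvd _ (minpoly.dvd ℝ N h0)
  exact eq_of_monic_of_associated ((minpoly_monic N).map _) hqm (associated_of_dvd_dvd hdvd' hdvd)

theorem conj_chart (γ : ℝ) (lam : OnePoint ℂ) :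
    chart γ (conjPoint lam) = starRingEnd ℂ (chart γ lam) := by
  induction lam using OnePoint.rec with
  | infty => simp [conjPoint]
  | coe z => simp [conjPoint]

/-- Since `γ` is real, the chart commutes with conjugation, which therefore only permutes the
factors. -/
theorem targetPoly_map_conj (γ : ℝ) (hμ : Function.Injective μ)
    (hconj : ∀ i, ∃ j, μ j = conjPoint (μ i))
    (hmconj : ∀ i j, μ j = conjPoint (μ i) → m i = m j) :
    (targetPoly γ μ m).map (starRingEnd ℂ) = targetPoly γ μ m := by
  choose σ hσ using hconj
  have hinv : Function.Involutive (conjPoint : OnePoint ℂ → OnePoint ℂ) := by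
    intro lam
    induction lam using OnePoint.rec <;> simp [conjPoint]
  have hσi : Function.Injective σ := fun i j hij =>
    hμ (hinv.injective (by rw [← hσ, ← hσ, hij]))
  rw [targetPoly, Polynomial.map_prod]
  refine Fintype.prod_bijective σ (Finite.injective_iff_bijective.1 hσi) _ _ fun i => ?_
  rw [Polynomial.map_pow, Polynomial.map_sub, map_X, map_C, hσ, conj_chart, hmconj i _ (hσ i)]

theorem exists_real_placement (P : MatrixPencil n) (hP : P.IsRegular) (hμ : Function.Injective μ)
    (hm : ∀ i, 0 < m i) (hsum : ∑ i, m i = P.sumLongestChains) (hreal : P.IsReal)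
    (hconj : ∀ i, ∃ j, μ j = conjPoint (μ i))
    (hmconj : ∀ i j, μ j = conjPoint (μ i) → m i = m j) :
    ∃ (α β : ℝ) (u v : Fin n → ℝ), α ≠ 0 ∧
      (P + rankOnePencil α β (fun i => (u i : ℂ)) (fun i => (v i : ℂ))).IsRegular ∧
      P.IsPlacement (P + rankOnePencil α β (fun i => (u i : ℂ)) (fun i => (v i : ℂ))) μ m ∧
      (n ≠ 0 → (n = 1 → ∀ i, μ i ∈ P.spec → μ i ≠ ∞) →
        (n = 2 → ∀ i, μ i ∈ P.spec → conjPoint (μ i) = μ i) →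
        (rankOnePencil (n := n) α β (fun i => (u i : ℂ)) (fun i => (v i : ℂ))).rank = 1) := by
  obtain ⟨γ, hB, hγ⟩ := exists_real_isUnit hP μ
  obtain ⟨E₀, A₀, hE₀, hA₀⟩ := hreal
  by_cases hdouble : n = 1 ∧ targetPoly γ μ m = minpoly ℂ (P.resolvent γ) ∧ P.E ≠ 0
  · obtain ⟨rfl, hp, hE⟩ := hdouble
    have hE0 : P.E 0 0 ≠ 0 := fun h => hE (by
      ext i j; rw [Subsingleton.elim i 0, Subsingleton.elim j 0, h]; rfl)
    obtain ⟨hreg, hpl⟩ := isRegular_and_isPlacement_double hB hμ hγ hm hp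
    have hone : (fun i => (((1 : Fin 1 → ℝ) i : ℝ) : ℂ)) = 1 := by ext; simp
    have hE1 : P.E 0 0 = (E₀ 0 0 : ℂ) := by rw [hE₀]; rfl
    have hA1 : P.A 0 0 = (A₀ 0 0 : ℂ) := by rw [hA₀]; rfl
    rw [hE1, hA1] at hreg hpl
    rw [hE1] at hE0
    refine ⟨E₀ 0 0, A₀ 0 0, 1, 1, by exact_mod_cast hE0, ?_⟩
    rw [hone]
    exact ⟨hreg, hpl, fun _ _ _ => rank_rankOnePencil hE0 one_ne_zero one_ne_zero⟩
  set B₀ := γ • E₀ - A₀ with hB₀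
  have hBmap : (γ : ℂ) • P.E - P.A = B₀.map Complex.ofRealHom := by
    rw [hE₀, hA₀, hB₀]; ext i j; simp
  have hB₀u : IsUnit B₀ := by
    rw [isUnit_iff_isUnit_det, hBmap, ← RingHom.mapMatrix_apply, ← RingHom.map_det] at hB
    rw [isUnit_iff_isUnit_det]
    exact (isUnit_map_iff Complex.ofRealHom _).1 hB
  set N := B₀⁻¹ * E₀ with hN
  have hres : P.resolvent γ = N.map Complex.ofRealHom := by
    apply hB.mul_left_cancel
    rw [mul_resolvent hB, hBmap, ← Matrix.map_mul, hN, ← mul_assoc,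
      mul_nonsing_inv _ ((isUnit_iff_isUnit_det _).1 hB₀u), one_mul, hE₀]
    rfl
  have hmin : (minpoly ℝ N).map Complex.ofRealHom = minpoly ℂ (P.resolvent γ) := by
    rw [hres, minpoly_map_ofReal]
  obtain ⟨p, hp⟩ := exists_map_ofReal_eq (targetPoly_map_conj γ hμ hconj hmconj)
  have hpm : p.Monic := by
    have := targetPoly_monic γ μ m
    rw [← hp] at this
    exact monic_of_injective Complex.ofReal_injective this
  have hpdeg : p.natDegree = (minpoly ℝ N).natDegree := by
    rw [← natDegree_map Complex.ofRealHom, hp, natDegree_targetPoly, hsum, sumLongestChains_eq hB,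
      ← hmin, natDegree_map]
  obtain ⟨u, v, heq, hne⟩ := exists_charpoly_add_vecMulVec N hpm hpdeg
  set uc : Fin n → ℂ := fun i => (u i : ℂ) with huc
  set vc : Fin n → ℂ := fun i => (v i : ℂ) with hvc
  have hstar : star vc = vc := by ext i; simp [hvc]
  have heq' : (P.resolvent γ + vecMulVec uc (star vc)).charpoly * minpoly ℂ (P.resolvent γ) =
      targetPoly γ μ m * (P.resolvent γ).charpoly := by
    have hadd : P.resolvent γ + vecMulVec uc (star vc) =
        (N + vecMulVec u v).map Complex.ofRealHom := by
      rw [hres, hstar]; ext i j; simp [vecMulVec_apply, huc, hvc]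
    rw [hadd, hres, charpoly_map, charpoly_map, ← minpoly_map_ofReal, ← hp, ← Polynomial.map_mul,
      heq, Polynomial.map_mul]
  obtain ⟨hreg, hpl⟩ := isRegular_and_isPlacement_add_rankOnePencil hB hμ hγ hm heq'
  have hBu : ((γ : ℂ) • P.E - P.A) *ᵥ uc = fun i => (((B₀ *ᵥ u) i : ℝ) : ℂ) := by
    rw [hBmap]
    ext i
    exact (RingHom.map_mulVec Complex.ofRealHom B₀ u i).symm
  rw [hBu] at hreg hpl
  refine ⟨1, γ, B₀ *ᵥ u, v, one_ne_zero, by simpa using hreg, by simpa using hpl,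
    fun hn h1 h2 => ?_⟩
  obtain ⟨hu, hv⟩ := hne fun hpq => by
    have hpc : targetPoly γ μ m = minpoly ℂ (P.resolvent γ) := by rw [← hp, hpq, hmin]
    have hspec := mem_spec_of_targetPoly_eq_minpoly hB hγ hm hpc
    have hnu := minpoly_not_isUnit hn N
    rcases (by omega : n = 1 ∨ n = 2 ∨ 3 ≤ n) with hn1 | hn2 | hn3
    · have hE : P.E = 0 := by
        by_contra hE
        exact hdouble ⟨hn1, hpc, hE⟩
      obtain ⟨i, hi⟩ := exists_target_eq_infty hn hγ hE hpc
      exact absurd hi (h1 hn1 i (hspec i))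
    · have hl : l ≠ 0 := by
        rintro rfl
        apply hnu
        have h1 : minpoly ℝ N = 1 := by
          refine Polynomial.map_injective _ Complex.ofReal_injective (hmin.trans ?_)
          rw [← hpc, Polynomial.map_one, targetPoly, Finset.univ_eq_empty, Finset.prod_empty]
        rw [h1]
        exact isUnit_one
      let i : Fin l := ⟨0, Nat.pos_of_ne_zero hl⟩
      -- A self-conjugate target has a real chart value, giving a linear real factor of the minimal
      -- polynomial, of degree `1 < 2`.
      have hi := conj_chart γ (μ i)
      rw [h2 hn2 i (hspec i)] at hi
      obtain ⟨t, ht⟩ := Complex.conj_eq_iff_real.1 hi.symm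
      refine ⟨X - C t, ?_, (irreducible_X_sub_C t).not_isUnit, by rw [natDegree_X_sub_C]; omega⟩
      have hroot := isRoot_targetPoly γ μ hm i
      rw [hpc, ← hmin, ht] at hroot
      exact dvd_iff_isRoot.2 (hroot.of_map Complex.ofReal_injective)
    -- Real irreducible polynomials have degree at most two, which is below `n` here.
    · obtain ⟨f, hf, hdvd⟩ := WfDvdMonoid.exists_irreducible_factor hnu (minpoly_monic _).ne_zero
      refine ⟨f, hdvd, hf.not_isUnit, ?_⟩
      have hf2 : f.natDegree ≤ 2 := natDegree_le_of_degree_le hf.degree_le_two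
      omega
  have hu' : uc ≠ 0 := fun h => hu (funext fun i => Complex.ofReal_eq_zero.1 (congrFun h i))
  have hv' : vc ≠ 0 := fun h => hv (funext fun i => Complex.ofReal_eq_zero.1 (congrFun h i))
  rw [← hBu]
  exact rank_rankOnePencil (by simp) (mulVec_ne_zero hB hu') hv'

end

end MatrixPencil

open MatrixPencil in
theorem theorem5p1 {n : ℕ} (P : MatrixPencil n) (hP : P.IsRegular)
    {l : ℕ} (μ : Fin l → OnePoint ℂ) (hμ : Function.Injective μ)
    (m : Fin l → ℕ) (hm : ∀ i, 0 < m i) (hsum : ∑ i, m i = P.sumLongestChains) :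
    (∃ (α β : ℂ) (u v : Fin n → ℂ), α ≠ 0 ∧
      (P + rankOnePencil α β u v).IsRegular ∧
      P.IsPlacement (P + rankOnePencil α β u v) μ m ∧
      (n ≠ 0 → (n = 1 → ∀ i, μ i ∈ P.spec → μ i ≠ ∞) →
        (rankOnePencil α β u v).rank = 1)) ∧
    (P.IsReal → (∀ i, ∃ j, μ j = conjPoint (μ i)) →
      (∀ i j, μ j = conjPoint (μ i) → m i = m j) →
      ∃ (α β : ℝ) (u v : Fin n → ℝ), α ≠ 0 ∧
        (P + rankOnePencil α β (fun i => (u i : ℂ)) (fun i => (v i : ℂ))).IsRegular ∧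
        P.IsPlacement (P + rankOnePencil α β (fun i => (u i : ℂ)) (fun i => (v i : ℂ))) μ m ∧
        (n ≠ 0 → (n = 1 → ∀ i, μ i ∈ P.spec → μ i ≠ ∞) →
          (n = 2 → ∀ i, μ i ∈ P.spec → conjPoint (μ i) = μ i) →
          (rankOnePencil (n := n) α β (fun i => (u i : ℂ)) (fun i => (v i : ℂ))).rank = 1)) :=
  ⟨exists_complex_placement P hP hμ hm hsum, exists_real_placement P hP hμ hm hsum⟩
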